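/- Let $p>5$ be a prime. Let $B_0,B_1,B_2,\ldots$ be the Bernoulli numbers, defined by $\frac{t}{e^t-1}=\sum_{n\ge 0}B_n\frac{t^n}{n!}$, and let $H_n=\sum_{0<k\le n}\frac1k$ be the harmonic numbers. For rational numbers $x,y$ and an integer $n\ge 1$, write $x\equiv y\pmod{p^n}$ if $x-y=p^n z$ for some rational number $z$ whose denominator in lowest terms is not divisible by $p$. Then $$\sum_{k=1}^{(p-1)/2}\frac{(-1)^k}{k^3\binom{2k}{k}}\equiv -2B_{p-3}\pmod{p},\tag{1.1}$$ $$\sum_{k=1}^{(p-1)/2}\frac{(-1)^k}{k^2}\binom{2k}{k}\equiv \frac{56}{15}\,p\,B_{p-3}\pmod{p^2},\tag{1.2}$$ $$\sum_{k=1}^{(p-1)/2}\frac{\binom{2k}{k}^2}{k\,16^k}\equiv -2H_{(p-1)/2}-\frac72\,p^2B_{p-3}\pmod{p^3},\tag{1.3}$$ $$-\frac{4}{p^2}\sum_{k=(p+1)/2}^{p-1}\frac{\binom{2k}{k}^2}{k\,16^k}\equiv\sum_{k=1}^{(p-1)/2}\frac{16^k}{k^3\binom{2k}{k}^2}\equiv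 -14B_{p-3}\pmod{p}.\tag{1.4}$$ -/

import Mathlib

/-- Congruence of rational numbers modulo `p ^ n` in the `p`-adic sense:
`x - y = p ^ n * z` for a rational number `z` that is a `p`-adic integer
(its denominator in lowest terms is not divisible by `p`). -/
def RatModEq (p n : ℕ) (x y : ℚ) : Prop :=
  ∃ z : ℚ, ¬ p ∣ z.den ∧ x - y = (p : ℚ) ^ n * z

open Finset

/-! Write n = (p-1)/2 and L_N(k) = (-1)^k C(N,k) C(N+k,k). Since (n+j)(n+1-j) = (p² - (2j-1)²)/4,
for k ≤ n the term L_n(k) equals C(2k,k)²/16^k up to a factor 1 + O(p²). Exact identities in N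
therefore become congruences at N = n: `sum_legendreTerm_div` gives the main term of the sum of
C(2k,k)²/(k 16^k), its derivative in t, `sum_legendreTerm_div_mul_logDerivSum`, gives the p²
correction, and `sum_one_div_legendreTerm` treats the reciprocals. All three are proved by
differencing in N, where the summand telescopes in k.

What remains are harmonic sums and two Apéry-like sums. `dualAperySum_eq` reduces the dual sum to
harmonic sums, and it is used both at n and at p-1. The reflection k ↦ p-k turns the difference of
these two values into 2p times `aperySum n` modulo p² (`aperySumZ_half`).

The harmonic sums needed are all multiples of B_{p-3}, by Faulhaber's formula: `sum_harmZ_div_sq`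
and `harmZ_three_half` are the two sources, and reflections produce the rest.

Only residues modulo p are ever computed; a congruence modulo a higher power is reached by first
dividing by a power of p. -/

/-- `legendreTerm t k` is `(-1) ^ k * choose t k * choose (t + k) k`, as a function of `t`. -/
def legendreTerm (t : ℚ) (k : ℕ) : ℚ :=
  ∏ j ∈ Icc 1 k, -((t + j) * (t + 1 - j) / (j : ℚ) ^ 2)

/-- The truncated sine product `∏ j ≤ k, (1 - t ^ 2 / j ^ 2)`. -/
def sineProd (t : ℚ) (k : ℕ) : ℚ :=
  ∏ j ∈ Icc 1 k, (1 - t ^ 2 / (j : ℚ) ^ 2)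

/-- `chooseRatio t k` is `choose (t + k) k / choose t k`, as a function of `t`. -/
def chooseRatio (t : ℚ) (k : ℕ) : ℚ :=
  ∏ j ∈ Icc 1 k, (t + j) / (t + 1 - j)

/-- The logarithmic derivative of `legendreTerm` with respect to `t`. -/
def logDerivSum (t : ℚ) (k : ℕ) : ℚ :=
  ∑ j ∈ Icc 1 k, (1 / (t + j) + 1 / (t + 1 - j))

/-- The generalized harmonic number `∑ k ≤ n, 1 / k ^ s`. -/
def harm (s n : ℕ) : ℚ := ∑ k ∈ Icc 1 n, 1 / (k : ℚ) ^ s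

/-- The sum `∑ k ≤ n, (-1) ^ k / (k ^ 3 * choose (2 k) k)`. -/
def aperySum (n : ℕ) : ℚ :=
  ∑ k ∈ Icc 1 n, (-1 : ℚ) ^ k / ((k : ℚ) ^ 3 * ((2 * k).choose k : ℚ))

/-- The sum `∑ k ≤ n, (-1) ^ k / k ^ 2 * choose (2 k) k`. -/
def dualAperySum (n : ℕ) : ℚ :=
  ∑ k ∈ Icc 1 n, (-1 : ℚ) ^ k / (k : ℚ) ^ 2 * ((2 * k).choose k : ℚ)

/-- The sum `∑ k ≤ n, (-1) ^ k / k ^ 2 * choose (n + k) k / choose n k`. -/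
def chooseRatioSum (n : ℕ) : ℚ :=
  ∑ k ∈ Icc 1 n, (-1 : ℚ) ^ k / (k : ℚ) ^ 2 * chooseRatio n k

/-! ### Recurrences in k and the shift t ↦ t - 1 -/

section steps
variable (t : ℚ) (k : ℕ)

@[simp] theorem legendreTerm_zero : legendreTerm t 0 = 1 := by simp [legendreTerm]
@[simp] theorem sineProd_zero : sineProd t 0 = 1 := by simp [sineProd]
@[simp] theorem chooseRatio_zero : chooseRatio t 0 = 1 := by simp [chooseRatio]
@[simp] theorem logDerivSum_zero : logDerivSum t 0 = 0 := by simp [logDerivSum]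

theorem legendreTerm_succ : legendreTerm t (k + 1) =
    legendreTerm t k * -((t + (k + 1)) * (t - k) / ((k : ℚ) + 1) ^ 2) := by
  rw [legendreTerm, prod_Icc_succ_top (by lia), ← legendreTerm]
  push_cast; ring

theorem sineProd_succ : sineProd t (k + 1) =
    sineProd t k * (1 - t ^ 2 / ((k : ℚ) + 1) ^ 2) := by
  rw [sineProd, prod_Icc_succ_top (by lia), ← sineProd]
  push_cast; ring

theorem chooseRatio_succ : chooseRatio t (k + 1) =
    chooseRatio t k * ((t + (k + 1)) / (t - k)) := by
  rw [chooseRatio, prod_Icc_succ_top (by lia), ← chooseRatio]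
  push_cast; congr 2; ring

theorem logDerivSum_succ : logDerivSum t (k + 1) =
    logDerivSum t k + (1 / (t + (k + 1)) + 1 / (t - k)) := by
  rw [logDerivSum, sum_Icc_succ_top (by lia), ← logDerivSum]
  push_cast; congr 3; ring

/-- Together with `legendreTerm_sub_one_mul_add` this writes the terms at t and at t - 1 through one
product S_k, as t S_k/(t-k) and t S_k/(t+k). That common factor is what makes differences in N
telescope. -/
theorem legendreTerm_mul_sub : legendreTerm t k * (t - k) = t * sineProd t k := by
  induction k with
  | zero => simp
  | succ k ih =>
    rw [legendreTerm_succ, sineProd_succ, ← mul_assoc, ← ih]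
    push_cast; field_simp; ring

theorem legendreTerm_sub_one_mul_add :
    legendreTerm (t - 1) k * (t + k) = t * sineProd t k := by
  induction k with
  | zero => simp
  | succ k ih =>
    rw [legendreTerm_succ, sineProd_succ, ← mul_assoc, ← ih]
    push_cast; field_simp; ring

/-- Free of the pole at t = k, so it covers the top term k = N + 1 at t = N + 1. -/
theorem legendreTerm_succ_eq_sineProd : legendreTerm t (k + 1) =
    -(t * (t + (k + 1)) / ((k : ℚ) + 1) ^ 2 * sineProd t k) := by
  rw [legendreTerm_succ]
  have := legendreTerm_mul_sub t k
  linear_combination -((t + (k + 1)) / ((k : ℚ) + 1) ^ 2) * this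

theorem logDerivSum_sub_one :
    logDerivSum t k - logDerivSum (t - 1) k = 1 / (t + k) - 1 / (t - k) := by
  induction k with
  | zero => simp
  | succ k ih =>
    rw [logDerivSum_succ, logDerivSum_succ]
    have e1 : t - 1 + ((k : ℚ) + 1) = t + k := by ring
    have e2 : t - 1 - (k : ℚ) = t - (k + 1) := by ring
    rw [e1, e2]
    push_cast
    linear_combination ih

end steps

/-! ### Values at natural numbers as binomial coefficients -/

theorem choose_two_mul_succ (k : ℕ) :
    ((2 * (k + 1)).choose (k + 1) : ℚ) * (k + 1) = 2 * (2 * k + 1) * ((2 * k).choose k : ℚ) := by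
  have := Nat.succ_mul_centralBinom_succ k
  simp only [Nat.centralBinom_eq_two_mul_choose] at this
  have h : (((k + 1) * (2 * (k + 1)).choose (k + 1) : ℕ) : ℚ) =
    ((2 * (2 * k + 1) * (2 * k).choose k : ℕ) : ℚ) := by rw [this]
  push_cast at h
  linear_combination h

theorem choose_two_mul_ne_zero (k : ℕ) : ((2 * k).choose k : ℚ) ≠ 0 := by
  exact_mod_cast (Nat.choose_pos (by lia)).ne'

theorem legendreTerm_natCast {N k : ℕ} (h : k ≤ N) :
    legendreTerm N k = (-1) ^ k * (N.choose k : ℚ) * ((N + k).choose k : ℚ) := by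
  induction k with
  | zero => simp
  | succ k ih =>
    rw [legendreTerm_succ, ih (by lia)]
    have h1 : (N.choose (k + 1) : ℚ) * (k + 1) = N.choose k * (N - k) := by
      have := Nat.choose_succ_right_eq N k
      rw [← Nat.cast_sub (by lia : k ≤ N)]; exact_mod_cast this
    have h2 : ((N + (k + 1)).choose (k + 1) : ℚ) * (k + 1) = (N + k).choose k * (N + k + 1) := by
      have := Nat.add_one_mul_choose_eq (N + k) k
      have h : (((N + k + 1) * (N + k).choose k : ℕ) : ℚ) =
        (((N + k + 1).choose (k + 1) * (k + 1) : ℕ) : ℚ) := by rw [this]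
      push_cast at h
      rw [← add_assoc]; linear_combination -h
    have hk : (k : ℚ) + 1 ≠ 0 := by positivity
    rw [pow_succ]
    field_simp
    linear_combination (-1) ^ k * ((N + (k + 1)).choose (k + 1) : ℚ) * (k + 1) * h1 +
      (-1) ^ k * (N.choose k : ℚ) * (N - k) * h2

theorem legendreTerm_self (N : ℕ) :
    legendreTerm N N = (-1) ^ N * ((2 * N).choose N : ℚ) := by
  rw [legendreTerm_natCast le_rfl, two_mul]; simp

theorem chooseRatio_natCast {N k : ℕ} (h : k ≤ N) :
    chooseRatio N k * (N.choose k : ℚ) = ((N + k).choose k : ℚ) := by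
  induction k with
  | zero => simp
  | succ k ih =>
    have ih := ih (by lia)
    rw [chooseRatio_succ]
    have h1 : (N.choose (k + 1) : ℚ) * (k + 1) = N.choose k * (N - k) := by
      have := Nat.choose_succ_right_eq N k
      rw [← Nat.cast_sub (by lia : k ≤ N)]; exact_mod_cast this
    have h2 : ((N + (k + 1)).choose (k + 1) : ℚ) * (k + 1) = (N + k).choose k * (N + k + 1) := by
      have := Nat.add_one_mul_choose_eq (N + k) k
      have h : (((N + k + 1) * (N + k).choose k : ℕ) : ℚ) =
        (((N + k + 1).choose (k + 1) * (k + 1) : ℕ) : ℚ) := by rw [this]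
      push_cast at h
      rw [← add_assoc]; linear_combination -h
    have hk : (k : ℚ) + 1 ≠ 0 := by positivity
    have hN : (N : ℚ) - k ≠ 0 := by
      have : (k : ℚ) + 1 ≤ N := by exact_mod_cast h
      intro h0; linarith
    rw [← mul_left_inj' hk, mul_assoc _ (N.choose (k + 1) : ℚ), h1, h2]
    field_simp
    linear_combination (N + (k + 1) : ℚ) * ih

theorem chooseRatio_self (N : ℕ) : chooseRatio N N = ((2 * N).choose N : ℚ) := by
  have := chooseRatio_natCast (le_refl N)
  rw [two_mul]; simpa using this

/-! ### Exact identities, by induction on N and telescoping in k -/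

theorem sum_legendreTerm_div (N : ℕ) :
    ∑ k ∈ Icc 1 N, legendreTerm N k / k = -2 * harm 1 N := by
  induction N with
  | zero => simp [harm]
  | succ N ih =>
    have hN : (N : ℚ) + 1 ≠ 0 := by positivity
    -- With t = N + 1 the summand is (2/t)(S_k - S_{k-1}). The bound m ≤ N keeps t - k nonzero.
    have key : ∀ m ≤ N, ∑ k ∈ Icc 1 m, (legendreTerm (N + 1) k - legendreTerm N k) / k =
        2 / ((N : ℚ) + 1) * (sineProd (N + 1) m - 1) := by
      intro m
      induction m with
      | zero => simp
      | succ m ihm =>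
        intro hm
        rw [sum_Icc_succ_top (by lia), ihm (by lia)]
        have h1 := legendreTerm_mul_sub ((N : ℚ) + 1) (m + 1)
        have h2 := legendreTerm_sub_one_mul_add ((N : ℚ) + 1) (m + 1)
        rw [sineProd_succ] at h1 h2 ⊢
        push_cast at h1 h2 ⊢
        have hm' : (m : ℚ) + 1 ≤ N := by exact_mod_cast hm
        have a1 : (N : ℚ) + 1 - (m + 1) ≠ 0 := by intro h; linarith
        have a2 : (N : ℚ) + 1 + (m + 1) ≠ 0 := by positivity
        have a3 : (m : ℚ) + 1 ≠ 0 := by positivity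
        rw [← eq_div_iff a1] at h1
        rw [add_sub_cancel_right, ← eq_div_iff a2] at h2
        rw [h1, h2]
        field_simp
        ring
    rw [sum_Icc_succ_top (by lia), harm, sum_Icc_succ_top (by lia), ← harm]
    have h3 := key N le_rfl
    -- The top term is -(2/t) S_N, which cancels the boundary term of `key` and leaves -2/(N+1).
    have h4 := legendreTerm_succ_eq_sineProd ((N : ℚ) + 1) N
    simp only [sub_div, sum_sub_distrib] at h3
    rw [ih] at h3
    push_cast
    rw [sub_eq_iff_eq_add] at h3
    rw [h3, h4]
    field_simp
    ring

theorem sum_neg_one_pow_mul_chooseRatio (N m : ℕ) (hm : m ≤ N) :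
    ∑ k ∈ Icc 1 m, (-1 : ℚ) ^ k * chooseRatio N k =
      (N + 1 + m) / (2 * (N + 1)) * ((-1) ^ m * chooseRatio N m) - 1 / 2 := by
  have hN : (N : ℚ) + 1 ≠ 0 := by positivity
  induction m with
  | zero => simp; field_simp; ring
  | succ m ih =>
    have hm' : (m : ℚ) + 1 ≤ N := by exact_mod_cast hm
    have a1 : (N : ℚ) - m ≠ 0 := by intro h; linarith
    rw [sum_Icc_succ_top (by lia), ih (by lia), chooseRatio_succ]
    push_cast
    field_simp
    ring

theorem chooseRatio_succ_left {N k : ℕ} (hk : k ≤ N) :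
    chooseRatio ((N : ℚ) + 1) k * ((N : ℚ) + 1) ^ 2 =
      chooseRatio N k * (((N : ℚ) + 1) ^ 2 - (k : ℚ) ^ 2) := by
  induction k with
  | zero => simp
  | succ k ih =>
    have hm' : (k : ℚ) + 1 ≤ N := by exact_mod_cast hk
    have a1 : (N : ℚ) - k ≠ 0 := by intro h; linarith
    have a2 : (N : ℚ) + 1 - k ≠ 0 := by intro h; linarith
    have ih := ih (by lia)
    rw [chooseRatio_succ, chooseRatio_succ, mul_right_comm, ih]
    push_cast
    field_simp
    ring

/-- By `chooseRatio_succ_left`, passing from N to N + 1 changes each summand by a multiple of k²,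
which removes the denominator; the alternating sum left over has the closed form
`sum_neg_one_pow_mul_chooseRatio`. -/
theorem dualAperySum_eq (N : ℕ) :
    5 / 2 * dualAperySum N = -harm 2 N + 2 * chooseRatioSum N := by
  induction N with
  | zero => simp [dualAperySum, harm, chooseRatioSum]
  | succ N ih =>
    have hN : (N : ℚ) + 1 ≠ 0 := by positivity
    have h1 : ∑ k ∈ Icc 1 N, (-1 : ℚ) ^ k / (k : ℚ) ^ 2 * chooseRatio ((N : ℚ) + 1) k =
        chooseRatioSum N - 1 / ((N : ℚ) + 1) ^ 2 *
          ∑ k ∈ Icc 1 N, (-1 : ℚ) ^ k * chooseRatio N k := by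
      rw [chooseRatioSum, mul_sum, ← sum_sub_distrib]
      refine sum_congr rfl fun k hk => ?_
      rw [mem_Icc] at hk
      have hk0 : (k : ℚ) ≠ 0 := by exact_mod_cast (by lia : k ≠ 0)
      have := chooseRatio_succ_left hk.2
      field_simp
      linear_combination this
    have h2 := choose_two_mul_succ N
    have h3 := chooseRatio_self N
    have h4 := chooseRatio_self (N + 1)
    push_cast at h4
    rw [dualAperySum, sum_Icc_succ_top (by lia), ← dualAperySum, harm,
      sum_Icc_succ_top (by lia), ← harm, chooseRatioSum, sum_Icc_succ_top (by lia)]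
    push_cast
    rw [h1, sum_neg_one_pow_mul_chooseRatio N N le_rfl, h3, h4, mul_add, ih]
    rw [← eq_div_iff hN] at h2
    rw [h2]
    field_simp
    ring

theorem sum_legendreTerm_div_mul_logDerivSum (N : ℕ) :
    ∑ k ∈ Icc 1 N, legendreTerm N k / k * logDerivSum N k =
      2 * harm 2 N + 5 / 2 * dualAperySum N := by
  induction N with
  | zero => simp [harm, dualAperySum]
  | succ N ih =>
    have hN : (N : ℚ) + 1 ≠ 0 := by positivity
    -- The right side is the t-derivative at t = N + 1 of (2/t)(S_m(t) - 1), the telescoped sum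
    -- behind `sum_legendreTerm_div`, with S_m'/S_m rewritten through the logarithmic derivative of
    -- t S_m/(t-m).
    have key : ∀ m ≤ N, ∑ k ∈ Icc 1 m, (legendreTerm (N + 1) k / k * logDerivSum (N + 1) k
          - legendreTerm N k / k * logDerivSum N k) =
        2 / ((N : ℚ) + 1) * sineProd (N + 1) m *
          (logDerivSum (N + 1) m + 1 / (N + 1 - m) - 2 / (N + 1)) + 2 / ((N : ℚ) + 1) ^ 2 := by
      intro m
      induction m with
      | zero => intro; simp; field_simp; ring
      | succ m ihm =>
        intro hm
        rw [sum_Icc_succ_top (by lia), ihm (by lia)]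
        have h1 := legendreTerm_mul_sub ((N : ℚ) + 1) (m + 1)
        have h2 := legendreTerm_sub_one_mul_add ((N : ℚ) + 1) (m + 1)
        have h3 := logDerivSum_sub_one ((N : ℚ) + 1) (m + 1)
        rw [logDerivSum_succ] at h3 ⊢
        rw [sineProd_succ] at h1 h2 ⊢
        push_cast at h1 h2 h3 ⊢
        have hm' : (m : ℚ) + 1 ≤ N := by exact_mod_cast hm
        have a1 : (N : ℚ) + 1 - (m + 1) ≠ 0 := by intro h; linarith
        have a2 : (N : ℚ) + 1 + (m + 1) ≠ 0 := by positivity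
        have a3 : (m : ℚ) + 1 ≠ 0 := by positivity
        have a4 : (N : ℚ) + 1 - m ≠ 0 := by intro h; linarith
        rw [← eq_div_iff a1] at h1
        rw [add_sub_cancel_right, ← eq_div_iff a2] at h2
        rw [add_sub_cancel_right, sub_eq_iff_eq_add, ← sub_eq_iff_eq_add'] at h3
        rw [h1, h2, ← h3]
        field_simp
        ring
    rw [sum_Icc_succ_top (by lia), harm, sum_Icc_succ_top (by lia), ← harm,
      dualAperySum, sum_Icc_succ_top (by lia), ← dualAperySum]
    have h3 := key N le_rfl
    have h4 := legendreTerm_succ_eq_sineProd ((N : ℚ) + 1) N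
    -- Here S_N does not cancel: it equals -1/2 times the diagonal term, and so brings in the
    -- central binomial coefficient.
    have h5 := legendreTerm_self (N + 1)
    push_cast at h5
    rw [h4] at h5
    rw [sum_sub_distrib, ih, sub_eq_iff_eq_add] at h3
    push_cast
    rw [h3, h4, logDerivSum_succ, div_mul_eq_mul_div ((-1 : ℚ) ^ (N + 1)), ← h5]
    field_simp
    ring

theorem sum_one_div_legendreTerm (N : ℕ) :
    ∑ k ∈ Icc 1 N, 1 / ((k : ℚ) ^ 3 * legendreTerm N k) = 2 * harm 3 N + 5 * aperySum N := by
  induction N with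
  | zero => simp [harm, aperySum]
  | succ N ih =>
    have hN : (N : ℚ) + 1 ≠ 0 := by positivity
    -- Now 1/S_k telescopes: the summand is (2/t³)(1/S_{k-1} - 1/S_k). Nonvanishing of S_m has to be
    -- carried through the induction.
    have key : ∀ m ≤ N, sineProd (N + 1) m ≠ 0 ∧
        ∑ k ∈ Icc 1 m, (1 / ((k : ℚ) ^ 3 * legendreTerm (N + 1) k) -
          1 / ((k : ℚ) ^ 3 * legendreTerm N k)) =
        2 / ((N : ℚ) + 1) ^ 3 * (1 - 1 / sineProd (N + 1) m) := by
      intro m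
      induction m with
      | zero => simp
      | succ m ihm =>
        intro hm
        obtain ⟨h0, ihm⟩ := ihm (by lia)
        rw [sum_Icc_succ_top (by lia), ihm]
        have h1 := legendreTerm_mul_sub ((N : ℚ) + 1) (m + 1)
        have h2 := legendreTerm_sub_one_mul_add ((N : ℚ) + 1) (m + 1)
        have h3 := sineProd_succ ((N : ℚ) + 1) m
        push_cast at h1 h2 ⊢
        have hm' : (m : ℚ) + 1 ≤ N := by exact_mod_cast hm
        have a1 : (N : ℚ) + 1 - (m + 1) ≠ 0 := by intro h; linarith
        have a2 : (N : ℚ) + 1 + (m + 1) ≠ 0 := by positivity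
        have a3 : (m : ℚ) + 1 ≠ 0 := by positivity
        have a5 : (1 - ((N : ℚ) + 1) ^ 2 / ((m : ℚ) + 1) ^ 2) =
            -(((N : ℚ) + 1 - (m + 1)) * ((N : ℚ) + 1 + (m + 1))) / ((m : ℚ) + 1) ^ 2 := by
          field_simp; ring
        rw [← eq_div_iff a1] at h1
        rw [add_sub_cancel_right, ← eq_div_iff a2] at h2
        rw [a5] at h3
        have h4 : sineProd ((N : ℚ) + 1) (m + 1) ≠ 0 := by
          rw [h3]
          exact mul_ne_zero h0 (div_ne_zero (neg_ne_zero.2 (mul_ne_zero a1 a2)) (by positivity))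
        refine ⟨h4, ?_⟩
        rw [h1, h2, h3]
        field_simp
        ring
    obtain ⟨h0, h3⟩ := key N le_rfl
    have h4 := legendreTerm_succ_eq_sineProd ((N : ℚ) + 1) N
    have h5 := legendreTerm_self (N + 1)
    push_cast at h5
    rw [h4] at h5
    rw [sum_Icc_succ_top (by lia), harm, sum_Icc_succ_top (by lia), ← harm,
      aperySum, sum_Icc_succ_top (by lia), ← aperySum]
    rw [sum_sub_distrib, ih, sub_eq_iff_eq_add] at h3
    have h6 : (-1 : ℚ) ^ (N + 1) * (-1) ^ (N + 1) = 1 := by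
      rw [← mul_pow]; norm_num
    have h7 := choose_two_mul_ne_zero (N + 1)
    have h8 : (-1 : ℚ) ^ (N + 1) / (((N : ℚ) + 1) ^ 3 * ((2 * (N + 1)).choose (N + 1) : ℚ)) =
        1 / (((N : ℚ) + 1) ^ 3 * ((-1) ^ (N + 1) * ((2 * (N + 1)).choose (N + 1) : ℚ))) := by
      rw [div_eq_div_iff (by positivity) (mul_ne_zero (by positivity)
        (mul_ne_zero (by positivity) h7))]
      linear_combination (((N : ℚ) + 1) ^ 3 * ((2 * (N + 1)).choose (N + 1) : ℚ)) * h6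
    push_cast
    rw [h3, h4, h8, ← h5]
    field_simp
    ring

/-! ### Alternating binomial sums -/

theorem sum_choose (N : ℕ) :
    ∑ k ∈ Icc 1 (N + 1), (-1 : ℚ) ^ k * ((N + 1).choose k : ℚ) = -1 := by
  have h := Int.alternating_sum_range_choose_of_ne (Nat.succ_ne_zero N)
  rw [Finset.range_eq_Ico, Finset.sum_eq_sum_Ico_succ_bot (by lia)] at h
  have h' : ((∑ k ∈ Ico 1 (N + 2), (-1 : ℤ) ^ k * ((N + 1).choose k : ℤ) : ℤ) : ℚ) = (-1 : ℤ) := by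
    congr 1
    simp at h
    lia
  push_cast at h'
  exact h'

/-- Differencing in N trades a factor 1/k for 1/(N+1), so each sum below reduces to the one with a
lower power of k. -/
theorem choose_succ_sub_div (N k : ℕ) (hk : 1 ≤ k) :
    (((N + 1).choose k : ℚ) - (N.choose k : ℚ)) / k = ((N + 1).choose k : ℚ) / (N + 1) := by
  obtain ⟨k, rfl⟩ := Nat.exists_eq_succ_of_ne_zero (by lia : k ≠ 0)
  have h1 := Nat.add_one_mul_choose_eq N k
  have h2 : (((N + 1) * N.choose k : ℕ) : ℚ) = (((N + 1).choose (k + 1) * (k + 1) : ℕ) : ℚ) := by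
    rw [h1]
  have h3 : (((N + 1).choose (k + 1) : ℕ) : ℚ) = ((N.choose k + N.choose (k + 1) : ℕ) : ℚ) := by
    rw [Nat.choose_succ_succ]
  push_cast at h2 h3 ⊢
  have hN : (N : ℚ) + 1 ≠ 0 := by positivity
  have hk : (k : ℚ) + 1 ≠ 0 := by positivity
  field_simp
  linear_combination h2 + (N + 1 : ℚ) * h3

theorem sum_choose_div (N : ℕ) :
    ∑ k ∈ Icc 1 N, (-1 : ℚ) ^ k * (N.choose k : ℚ) / k = -harm 1 N := by
  induction N with
  | zero => simp [harm]
  | succ N ih =>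
    have h1 : ∑ k ∈ Icc 1 (N + 1), (-1 : ℚ) ^ k * (((N + 1).choose k : ℚ)) / k =
        ∑ k ∈ Icc 1 (N + 1), (-1 : ℚ) ^ k * (N.choose k : ℚ) / k +
          (∑ k ∈ Icc 1 (N + 1), (-1 : ℚ) ^ k * ((N + 1).choose k : ℚ)) / (N + 1) := by
      rw [sum_div, ← sum_add_distrib]
      refine sum_congr rfl fun k hk => ?_
      have := choose_succ_sub_div N k (mem_Icc.1 hk).1
      linear_combination (-1 : ℚ) ^ k * this
    rw [h1, sum_choose, sum_Icc_succ_top (by lia), ih, harm, harm, sum_Icc_succ_top (by lia)]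
    simp
    ring

theorem sum_choose_div_sq (N : ℕ) :
    ∑ k ∈ Icc 1 N, (-1 : ℚ) ^ k * (N.choose k : ℚ) / (k : ℚ) ^ 2 =
      -(harm 1 N ^ 2 + harm 2 N) / 2 := by
  induction N with
  | zero => simp [harm]
  | succ N ih =>
    have h1 : ∑ k ∈ Icc 1 (N + 1), (-1 : ℚ) ^ k * (((N + 1).choose k : ℚ)) / (k : ℚ) ^ 2 =
        ∑ k ∈ Icc 1 (N + 1), (-1 : ℚ) ^ k * (N.choose k : ℚ) / (k : ℚ) ^ 2 +
          (∑ k ∈ Icc 1 (N + 1), (-1 : ℚ) ^ k * ((N + 1).choose k : ℚ) / k) / (N + 1) := by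
      rw [sum_div, ← sum_add_distrib]
      refine sum_congr rfl fun k hk => ?_
      have := choose_succ_sub_div N k (mem_Icc.1 hk).1
      have hk0 : (k : ℚ) ≠ 0 := by exact_mod_cast (by have := (mem_Icc.1 hk).1; lia : k ≠ 0)
      linear_combination (-1 : ℚ) ^ k / k * this
    have h2 : ∀ s, harm s (N + 1) = harm s N + 1 / ((N : ℚ) + 1) ^ s := fun s => by
      rw [harm, sum_Icc_succ_top (by lia), ← harm]; push_cast; rfl
    have hN : (N : ℚ) + 1 ≠ 0 := by positivity
    rw [h1, sum_choose_div, sum_Icc_succ_top (by lia), ih, h2, h2]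
    simp
    field_simp
    ring

/-! ### Calculus of residues of p-integral rationals -/

/-- `Red p x a`: the rational number `x` is a `p`-adic integer with residue `a` modulo `p`. -/
def Red (p : ℕ) (x : ℚ) (a : ZMod p) : Prop :=
  ∃ m d : ℤ, (d : ZMod p) ≠ 0 ∧ x * d = m ∧ a * d = m

namespace Red

theorem of_eq {p : ℕ} {x y : ℚ} {a b : ZMod p} (hx : Red p x a) (hxy : x = y) (hab : a = b) :
    Red p y b := hxy ▸ hab ▸ hx

variable {p : ℕ} [Fact p.Prime] {x y : ℚ} {a b : ZMod p}

theorem natCast (n : ℕ) : Red p n n := ⟨n, 1, by simp, by simp, by simp⟩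

theorem ofNat (n : ℕ) [n.AtLeastTwo] : Red p (OfNat.ofNat n) (OfNat.ofNat n) := by
  exact_mod_cast natCast (p := p) (OfNat.ofNat n)

theorem zero : Red p 0 0 := by simpa using natCast (p := p) 0

theorem one : Red p 1 1 := by simpa using natCast (p := p) 1

theorem prime : Red p p 0 := by simpa using natCast (p := p) p

theorem add (hx : Red p x a) (hy : Red p y b) : Red p (x + y) (a + b) := by
  obtain ⟨m, d, hd, h1, h2⟩ := hx
  obtain ⟨m', d', hd', h1', h2'⟩ := hy
  refine ⟨m * d' + m' * d, d * d', by push_cast; exact mul_ne_zero hd hd', ?_, ?_⟩ <;> push_cast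
  · linear_combination (d' : ℚ) * h1 + d * h1'
  · linear_combination (d' : ZMod p) * h2 + d * h2'

theorem mul (hx : Red p x a) (hy : Red p y b) : Red p (x * y) (a * b) := by
  obtain ⟨m, d, hd, h1, h2⟩ := hx
  obtain ⟨m', d', hd', h1', h2'⟩ := hy
  refine ⟨m * m', d * d', by push_cast; exact mul_ne_zero hd hd', ?_, ?_⟩ <;> push_cast
  · rw [← h1, ← h1']; ring
  · rw [← h2, ← h2']; ring

theorem neg (hx : Red p x a) : Red p (-x) (-a) := by
  obtain ⟨m, d, hd, h1, h2⟩ := hx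
  exact ⟨-m, d, hd, by push_cast; linear_combination -h1, by push_cast; linear_combination -h2⟩

theorem sub (hx : Red p x a) (hy : Red p y b) : Red p (x - y) (a - b) := by
  simpa [sub_eq_add_neg] using hx.add hy.neg

theorem inv (hx : Red p x a) (ha : a ≠ 0) : Red p x⁻¹ a⁻¹ := by
  obtain ⟨m, d, hd, h1, h2⟩ := hx
  have hm : (m : ZMod p) ≠ 0 := by rw [← h2]; exact mul_ne_zero ha hd
  have hm0 : (m : ℚ) ≠ 0 := by
    intro h
    rw [Int.cast_eq_zero] at h
    simp [h] at hm
  have hx0 : x ≠ 0 := by rintro rfl; simp at h1; exact hm0 h1.symm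
  exact ⟨d, m, hm, by field_simp; linear_combination -h1, by field_simp; linear_combination -h2⟩

theorem div (hx : Red p x a) (hy : Red p y b) (hb : b ≠ 0) : Red p (x / y) (a / b) := by
  rw [div_eq_mul_inv, div_eq_mul_inv]; exact hx.mul (hy.inv hb)

theorem pow (hx : Red p x a) (n : ℕ) : Red p (x ^ n) (a ^ n) := by
  induction n with
  | zero => simp [one]
  | succ n ih => simpa [pow_succ] using ih.mul hx

theorem sum {ι : Type*} {s : Finset ι} {f : ι → ℚ} {g : ι → ZMod p}
    (h : ∀ i ∈ s, Red p (f i) (g i)) : Red p (∑ i ∈ s, f i) (∑ i ∈ s, g i) := by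
  classical
  induction s using Finset.induction_on with
  | empty => simpa using zero
  | insert i s hi ih =>
    rw [sum_insert hi, sum_insert hi]
    exact (h i (mem_insert_self _ _)).add (ih fun j hj => h j (mem_insert_of_mem hj))

theorem unique (hx : Red p x a) (hy : Red p x b) : a = b := by
  obtain ⟨m, d, hd, h1, h2⟩ := hx
  obtain ⟨m', d', hd', h1', h2'⟩ := hy
  have h : m * d' = m' * d := by
    have : ((m * d' : ℤ) : ℚ) = ((m' * d : ℤ) : ℚ) := by
      push_cast; rw [← h1, ← h1']; ring
    exact_mod_cast this
  have h' : (m : ZMod p) * d' = m' * d := by exact_mod_cast congrArg (Int.cast (R := ZMod p)) h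
  rw [← h2, ← h2'] at h'
  apply mul_right_cancel₀ (mul_ne_zero hd hd')
  linear_combination h'

theorem not_dvd_den (hx : Red p x a) : ¬ p ∣ x.den := by
  obtain ⟨m, d, hd, h1, -⟩ := hx
  have hd0 : (d : ℚ) ≠ 0 := by rintro h; rw [Int.cast_eq_zero] at h; simp [h] at hd
  have hx : x = Rat.divInt m d := by
    rw [Rat.divInt_eq_div, eq_div_iff (by exact_mod_cast hd0)]; exact_mod_cast h1
  have h3 : (x.den : ℤ) ∣ d := hx ▸ Rat.den_dvd m d
  intro h
  exact hd ((ZMod.intCast_zmod_eq_zero_iff_dvd _ _).2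
    ((Int.natCast_dvd_natCast.2 h).trans h3))

/-- A `p`-adic integer with residue zero is divisible by `p`. -/
theorem div_prime (hx : Red p x 0) : ∃ c, Red p (x / p) c := by
  obtain ⟨m, d, hd, h1, h2⟩ := hx
  rw [zero_mul, eq_comm, ZMod.intCast_zmod_eq_zero_iff_dvd] at h2
  obtain ⟨m, rfl⟩ := h2
  have hp : (p : ℚ) ≠ 0 := by exact_mod_cast (Fact.out : p.Prime).ne_zero
  refine ⟨m / d, m, d, hd, ?_, by field_simp⟩
  push_cast at h1
  field_simp
  linear_combination h1

/-- A product of factors congruent to one modulo `p`, to first order. -/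
theorem prod_one_add {ι : Type*} {s : Finset ι} {q : ℚ} (hq : Red p q 0) (hq0 : q ≠ 0)
    {f : ι → ℚ} {g : ι → ZMod p}
    (h : ∀ i ∈ s, Red p (f i) (g i)) :
    Red p ((∏ i ∈ s, (1 + q * f i) - 1) / q) (∑ i ∈ s, g i) := by
  classical
  induction s using Finset.induction_on with
  | empty => simp [zero]
  | insert i s hi ih =>
    rw [prod_insert hi, sum_insert hi]
    have h1 := h i (mem_insert_self _ _)
    have h2 := ih fun j hj => h j (mem_insert_of_mem hj)
    refine (h1.add (((one.add (hq.mul h1)).mul h2))).of_eq ?_ (by ring)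
    field_simp
    ring

theorem ratModEq {n : ℕ} (h : Red p ((x - y) / (p : ℚ) ^ n) a) : RatModEq p n x y := by
  have hp : (p : ℚ) ≠ 0 := by exact_mod_cast (Fact.out : p.Prime).ne_zero
  exact ⟨_, h.not_dvd_den, by field_simp⟩

/-- Equality of residues after division by p^n gains one further power of p. -/
theorem ratModEq_succ {n : ℕ} (hx : Red p (x / (p : ℚ) ^ n) a) (hy : Red p y a) :
    RatModEq p (n + 1) x ((p : ℚ) ^ n * y) := by
  have hp : (p : ℚ) ≠ 0 := by exact_mod_cast (Fact.out : p.Prime).ne_zero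
  obtain ⟨c, hc⟩ := div_prime ((hx.sub hy).of_eq rfl (sub_self a))
  refine ratModEq (a := c) (hc.of_eq ?_ rfl)
  rw [pow_succ]
  field_simp

end Red

theorem natCast_zmod_ne_zero {p k : ℕ} (h1 : 1 ≤ k) (h2 : k < p) : (k : ZMod p) ≠ 0 := by
  intro h
  rw [ZMod.natCast_eq_zero_iff] at h
  exact absurd (Nat.le_of_dvd (by lia) h) (by lia)

/-! ### Reflections of sums over 1, …, p - 1 -/

section reflection

variable {M : Type*} [AddCommMonoid M]

theorem sum_Icc_split_reflect {p n : ℕ} (hn : p = 2 * n + 1) (f : ℕ → M) :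
    ∑ k ∈ Icc (n + 1) (p - 1), f k = ∑ k ∈ Icc 1 n, f (p - k) := by
  refine sum_nbij' (fun k => p - k) (fun k => p - k) ?_ ?_ ?_ ?_ ?_ <;>
    intro k hk <;> rw [mem_Icc] at * <;> first | lia | skip
  congr 1; lia

theorem sum_Icc_eq_add_upper {p n : ℕ} (hn : p = 2 * n + 1) (f : ℕ → M) :
    ∑ k ∈ Icc 1 (p - 1), f k = ∑ k ∈ Icc 1 n, f k + ∑ k ∈ Icc (n + 1) (p - 1), f k := by
  have := Finset.sum_Ioc_consecutive f (Nat.zero_le n) (by lia : n ≤ p - 1)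
  simp only [← Finset.Icc_add_one_left_eq_Ioc] at this
  simpa using this.symm

theorem sum_Icc_reflect {p n : ℕ} (hn : p = 2 * n + 1) (f : ℕ → M) :
    ∑ k ∈ Icc 1 (p - 1), f k = ∑ k ∈ Icc 1 n, (f k + f (p - k)) := by
  rw [sum_Icc_eq_add_upper hn, sum_Icc_split_reflect hn, sum_add_distrib]

/-- As p is odd, p - 2k runs over the odd numbers below p. -/
theorem sum_Icc_even_reflect {p n : ℕ} (hn : p = 2 * n + 1) (f : ℕ → M) :
    ∑ k ∈ Icc 1 (p - 1), f k = ∑ k ∈ Icc 1 n, (f (2 * k) + f (p - 2 * k)) := by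
  rw [← sum_filter_add_sum_filter_not _ (fun k => Even k), sum_add_distrib]
  congr 1
  · refine sum_nbij' (fun k => k / 2) (fun k => 2 * k) ?_ ?_ ?_ ?_ ?_ <;>
      intro k hk <;> simp only [mem_filter, mem_Icc, Nat.even_iff] at * <;> first | lia | skip
    congr 1; lia
  · refine sum_nbij' (fun k => (p - k) / 2) (fun k => p - 2 * k) ?_ ?_ ?_ ?_ ?_ <;>
      intro k hk <;> simp only [mem_filter, mem_Icc, Nat.even_iff] at * <;> first | lia | skip
    congr 1; lia

end reflection

/-! ### Binomial quantities as products of factors close to 1 -/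

theorem neg_one_pow_mul_choose {N k : ℕ} (hk : k ≤ N) :
    (-1 : ℚ) ^ k * (N.choose k : ℚ) = ∏ j ∈ Icc 1 k, (1 + ((N : ℚ) + 1) * (-(1 / (j : ℚ) ^ 1))) := by
  induction k with
  | zero => simp
  | succ k ih =>
    rw [prod_Icc_succ_top (by lia), ← ih (by lia)]
    have h1 : (N.choose (k + 1) : ℚ) * (k + 1) = N.choose k * (N - k) := by
      have := Nat.choose_succ_right_eq N k
      rw [← Nat.cast_sub (by lia : k ≤ N)]; exact_mod_cast this
    have hk1 : (k : ℚ) + 1 ≠ 0 := by positivity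
    rw [← eq_div_iff hk1] at h1
    rw [h1]
    push_cast
    field_simp
    ring

theorem neg_one_pow_mul_chooseRatio_half {p n k : ℕ} (hn : p = 2 * n + 1) (hk : k ≤ n) :
    (-1 : ℚ) ^ k * chooseRatio n k = ∏ j ∈ Icc 1 k, (1 + (p : ℚ) * (2 / (2 * (j : ℚ) - 1 - p))) := by
  induction k with
  | zero => simp
  | succ k ih =>
    have hk' : (k : ℚ) + 1 ≤ n := by exact_mod_cast hk
    rw [prod_Icc_succ_top (by lia), ← ih (by lia), chooseRatio_succ, hn]
    push_cast
    have h1 : (n : ℚ) - k ≠ 0 := by intro h; linarith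
    have h2 : 2 * ((k : ℚ) + 1) - 1 - (2 * n + 1) = -2 * (n - k) := by ring
    rw [h2]
    field_simp
    ring

theorem legendreTerm_half {p n k : ℕ} (hn : p = 2 * n + 1) :
    legendreTerm n k = ((2 * k).choose k : ℚ) ^ 2 / 16 ^ k *
      ∏ j ∈ Icc 1 k, (1 + (p : ℚ) ^ 2 * -(1 / (2 * (j : ℚ) - 1) ^ 2)) := by
  induction k with
  | zero => simp
  | succ k ih =>
    have h := choose_two_mul_succ k
    have hk : (k : ℚ) + 1 ≠ 0 := by positivity
    have hk' : 2 * (k : ℚ) + 1 ≠ 0 := by positivity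
    rw [← eq_div_iff hk] at h
    rw [prod_Icc_succ_top (by lia), legendreTerm_succ, ih, h, hn]
    push_cast
    rw [show 2 * ((k : ℚ) + 1) - 1 = 2 * k + 1 by ring, pow_succ (16 : ℚ)]
    field_simp
    ring

/-- The two fractions have denominators adding up to 2n + 1 = p, hence the factor p. -/
theorem logDerivSum_half {p n k : ℕ} (hn : p = 2 * n + 1) (hk : k ≤ n) :
    logDerivSum n k = p * ∑ j ∈ Icc 1 k, 4 / ((p : ℚ) ^ 2 - (2 * (j : ℚ) - 1) ^ 2) := by
  rw [logDerivSum, mul_sum]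
  refine sum_congr rfl fun j hj => ?_
  rw [mem_Icc] at hj
  have h1 : (n : ℚ) + j ≠ 0 := by exact_mod_cast (by lia : n + j ≠ 0)
  have h2 : (n : ℚ) + 1 - j ≠ 0 := by
    have : (j : ℚ) ≤ n := by exact_mod_cast hj.2.trans hk
    intro h; linarith
  have h3 : (p : ℚ) ^ 2 - (2 * (j : ℚ) - 1) ^ 2 = 4 * ((n + j) * (n + 1 - j)) := by
    rw [hn]; push_cast; ring
  rw [h3, hn]
  push_cast
  field_simp
  ring

/-! ### Harmonic and Bernoulli numbers modulo p -/

variable {p : ℕ} [Fact p.Prime]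

/-- The residue of `harm s n` modulo `p`, for `n < p`. -/
def harmZ (p : ℕ) [Fact p.Prime] (s n : ℕ) : ZMod p := ∑ k ∈ Icc 1 n, 1 / (k : ZMod p) ^ s

@[simp] theorem harmZ_zero (s : ℕ) : harmZ p s 0 = 0 := by simp [harmZ]

theorem harmZ_succ (p : ℕ) [Fact p.Prime] (s n : ℕ) : harmZ p s (n + 1) = harmZ p s n + 1 / ((n : ZMod p) + 1) ^ s := by
  rw [harmZ, sum_Icc_succ_top (by lia), ← harmZ]; push_cast; rfl

theorem red_harm (s : ℕ) {n : ℕ} (hn : n < p) : Red p (harm s n) (harmZ p s n) := by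
  refine Red.sum fun k hk => ?_
  rw [mem_Icc] at hk
  exact Red.one.div ((Red.natCast k).pow s) (pow_ne_zero _ (natCast_zmod_ne_zero hk.1 (by lia)))

theorem natCast_prime_sub {k : ℕ} (hk : k ≤ p) : ((p - k : ℕ) : ZMod p) = -k := by
  rw [Nat.cast_sub hk]; simp

theorem harmZ_prime_sub_one_of_odd {s n : ℕ} (hn : p = 2 * n + 1) (hs : Odd s) :
    harmZ p s (p - 1) = 0 := by
  rw [harmZ, sum_Icc_reflect hn]
  refine sum_eq_zero fun k hk => ?_
  rw [mem_Icc] at hk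
  rw [natCast_prime_sub (by lia), hs.neg_pow, div_neg, add_neg_cancel]

theorem harmZ_one_reflect {n : ℕ} (hn : p = 2 * n + 1) {k : ℕ} (hk : k < p) :
    harmZ p 1 (p - 1 - k) = harmZ p 1 k := by
  induction k with
  | zero => rw [Nat.sub_zero, harmZ_prime_sub_one_of_odd hn (by decide), harmZ_zero]
  | succ k ih =>
    have h1 := harmZ_succ p 1 (p - 1 - (k + 1))
    rw [show p - 1 - (k + 1) + 1 = p - 1 - k by lia, ih (by lia)] at h1
    have h2 : ((p - 1 - (k + 1) : ℕ) : ZMod p) + 1 = -((k : ZMod p) + 1) := by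
      have := natCast_prime_sub (p := p) (k := k + 1) (by lia)
      rw [show p - (k + 1) = (p - 1 - (k + 1)) + 1 by lia] at this
      push_cast at this ⊢; exact this
    rw [h2] at h1
    rw [harmZ_succ, h1, pow_one, pow_one, div_neg, neg_add_cancel_right]

theorem harmZ_one_prime_sub {n : ℕ} (hn : p = 2 * n + 1) {k : ℕ} (h1 : 1 ≤ k) (hk : k < p) :
    harmZ p 1 (p - k) = harmZ p 1 k - 1 / k := by
  obtain ⟨k, rfl⟩ := Nat.exists_eq_succ_of_ne_zero (by lia : k ≠ 0)
  have := harmZ_one_reflect hn (by lia : k < p)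
  rw [Nat.succ_eq_add_one, show p - (k + 1) = p - 1 - k by lia, this, harmZ_succ]
  push_cast; ring

/-- The recurrence for B_r divides only by r + 1, a unit modulo p in this range. -/
theorem exists_red_bernoulli {r : ℕ} (hr : r + 1 < p) : ∃ b, Red p (bernoulli r) b := by
  induction r using Nat.strong_induction_on with
  | _ r ih =>
    have h := sum_bernoulli (r + 1)
    rw [sum_range_succ] at h
    have hr1 : ((r + 1 : ℕ) : ZMod p) ≠ 0 := natCast_zmod_ne_zero (by lia) hr
    have hr2 : ((r + 1 : ℕ) : ℚ) ≠ 0 := by positivity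
    have h2 : bernoulli r = ((if r + 1 = 1 then 1 else 0) -
        ∑ k ∈ range r, ((r + 1).choose k : ℚ) * bernoulli k) / ((r + 1 : ℕ) : ℚ) := by
      rw [eq_div_iff hr2, ← h]
      simp only [Nat.choose_succ_self_right]
      ring
    have ih' : ∀ k, ∃ b, k < r → Red p (bernoulli k) b := fun k => by
      by_cases hk : k < r
      · obtain ⟨b, hb⟩ := ih k hk (by lia)
        exact ⟨b, fun _ => hb⟩
      · exact ⟨0, fun h => absurd h hk⟩
    choose b hb using ih'
    have h3 : Red p (if r + 1 = 1 then 1 else 0) (if r + 1 = 1 then 1 else 0) := by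
      split_ifs
      exacts [Red.one, Red.zero]
    rw [h2]
    exact ⟨_, (h3.sub (Red.sum fun k hk =>
      (Red.natCast ((r + 1).choose k)).mul (hb k (mem_range.1 hk)))).div (Red.natCast _) hr1⟩

/-- In Faulhaber's formula every term except the B_m one contains p² or a higher power. -/
theorem red_sum_range_pow_div {m : ℕ} (hm : m + 1 < p) {β : ZMod p}
    (hβ : Red p (bernoulli m) β) : Red p ((∑ j ∈ range p, (j : ℚ) ^ m) / p) β := by
  have hp : (p : ℚ) ≠ 0 := by exact_mod_cast (Fact.out : p.Prime).ne_zero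
  have hm1 : ((m + 1 : ℕ) : ZMod p) ≠ 0 := natCast_zmod_ne_zero (by lia) hm
  rw [sum_range_pow, sum_range_succ, add_div, sum_div]
  have h1 : Red p (∑ i ∈ range m,
      bernoulli i * ((m + 1).choose i : ℚ) * (p : ℚ) ^ (m + 1 - i) / ((m : ℚ) + 1) / p) 0 := by
    rw [← sum_const_zero (s := range m)]
    refine Red.sum fun i hi => ?_
    rw [mem_range] at hi
    obtain ⟨b, hb⟩ := exists_red_bernoulli (p := p) (r := i) (by lia)
    refine ((((hb.mul (Red.natCast ((m + 1).choose i))).mul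
      (Red.prime.pow (m - i))).div (Red.natCast (m + 1)) hm1)).of_eq ?_ ?_
    · rw [show m + 1 - i = (m - i) + 1 by lia, pow_succ]
      push_cast
      field_simp
    · rw [zero_pow (by lia)]; simp
  have h2 : (m : ℚ) + 1 ≠ 0 := by positivity
  refine (h1.add hβ).of_eq ?_ (zero_add β)
  simp [Nat.choose_succ_self_right]
  field_simp

theorem zmod_pow_prime_sub {e : ℕ} (he : e + 1 < p) (x : ZMod p) (he0 : 1 ≤ e) :
    x ^ (p - 1 - e) = 1 / x ^ e := by
  by_cases hx : x = 0
  · subst hx; rw [zero_pow (by lia), zero_pow (by lia)]; simp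
  · rw [eq_div_iff (pow_ne_zero _ hx), ← pow_add, show p - 1 - e + e = p - 1 by lia]
    exact ZMod.pow_card_sub_one_eq_one hx

theorem sum_zmod_pow {e : ℕ} (he0 : 1 ≤ e) (he : e + 1 < p) :
    ∑ k ∈ Icc 1 (p - 1), (k : ZMod p) ^ e = 0 := by
  obtain ⟨b, hb⟩ := exists_red_bernoulli he
  have hp : (p : ℚ) ≠ 0 := by exact_mod_cast (Fact.out : p.Prime).ne_zero
  have h1 := (Red.prime.mul (red_sum_range_pow_div he hb))
  rw [mul_div_cancel₀ _ hp, zero_mul] at h1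
  have h2 : Red p (∑ j ∈ range p, (j : ℚ) ^ e) (∑ j ∈ range p, (j : ZMod p) ^ e) :=
    Red.sum fun j _ => (Red.natCast j).pow e
  have h3 := h2.unique h1
  rw [range_eq_Ico, sum_eq_sum_Ico_succ_bot (Fact.out : p.Prime).pos] at h3
  rw [Nat.cast_zero, zero_pow (by lia), zero_add] at h3
  rw [← h3]
  congr 1

/-- Modulo p, 1/j = j^(p-2), so Faulhaber makes H_{k-1} a polynomial in k. After division by k² and
summation over k, nonconstant powers vanish and the B_{p-3} term remains. -/
theorem sum_harmZ_div_sq {n : ℕ} (hn : p = 2 * n + 1) (hp5 : 5 < p) {β : ZMod p}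
    (hβ : Red p (bernoulli (p - 3)) β) :
    ∑ k ∈ Icc 1 (p - 1), harmZ p 1 k / (k : ZMod p) ^ 2 = β := by
  have hb : ∀ k, ∃ b, k + 1 < p → Red p (bernoulli k) b := fun k => by
    by_cases hk : k + 1 < p
    · obtain ⟨b, hb⟩ := exists_red_bernoulli hk
      exact ⟨b, fun _ => hb⟩
    · exact ⟨0, fun h => absurd h hk⟩
  choose b hb using hb
  have hp1 : ((p - 1 : ℕ) : ZMod p) = -1 := by
    simpa using natCast_prime_sub (p := p) (k := 1) (by lia)
  have faul : ∀ k : ℕ, ∑ j ∈ range k, (j : ZMod p) ^ (p - 2) =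
      -∑ i ∈ range (p - 1), b i * ((p - 1).choose i : ZMod p) * (k : ZMod p) ^ (p - 1 - i) := by
    intro k
    have h1 : Red p (∑ j ∈ range k, (j : ℚ) ^ (p - 2)) (∑ j ∈ range k, (j : ZMod p) ^ (p - 2)) :=
      Red.sum fun j _ => (Red.natCast j).pow _
    refine h1.unique ?_
    rw [sum_range_pow, ← sum_neg_distrib]
    have e1 : p - 2 + 1 = p - 1 := by lia
    have e2 : ((p - 2 : ℕ) : ℚ) + 1 = ((p - 1 : ℕ) : ℚ) := by rw [← e1]; push_cast; rfl
    rw [e2, e1]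
    refine Red.sum fun i hi => ?_
    rw [mem_range] at hi
    refine (((hb i (by lia)).mul (Red.natCast _)).mul ((Red.natCast k).pow _)).div
      (Red.natCast (p - 1)) (by rw [hp1]; simp) |>.of_eq rfl ?_
    rw [hp1, div_neg, div_one]
  have harm_eq : ∀ k, harmZ p 1 k = ∑ j ∈ range k, (j : ZMod p) ^ (p - 2) + 1 / (k : ZMod p) := by
    intro k
    have hinv : ∀ x : ZMod p, x ^ (p - 2) = 1 / x := fun x => by
      have := zmod_pow_prime_sub (p := p) (e := 1) (by lia) x le_rfl
      rwa [pow_one, show p - 1 - 1 = p - 2 by lia] at this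
    rw [← hinv, ← sum_range_succ]
    induction k with
    | zero => simp [zero_pow (by lia : p - 2 ≠ 0)]
    | succ k ih => rw [harmZ_succ, ih, sum_range_succ _ (k + 1), hinv ((k + 1 : ℕ) : ZMod p)]; simp
  have h3 := harmZ_prime_sub_one_of_odd hn (by decide : Odd 3)
  have step : ∀ k ∈ Icc 1 (p - 1), harmZ p 1 k / (k : ZMod p) ^ 2 =
      -(∑ i ∈ range (p - 2), b i * ((p - 1).choose i : ZMod p) * (k : ZMod p) ^ (p - 3 - i)) +
        1 / (k : ZMod p) ^ 3 := by
    intro k hk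
    rw [mem_Icc] at hk
    have hk0 : (k : ZMod p) ≠ 0 := natCast_zmod_ne_zero hk.1 (by lia)
    -- The linear term in k would become 1/k after dividing by k²; its coefficient B_{p-2} is zero
    -- because p - 2 is odd and exceeds 1.
    have hlast : b (p - 2) = 0 := by
      refine (hb (p - 2) (by lia)).unique ?_
      rw [bernoulli_eq_zero_of_odd ⟨n - 1, by lia⟩ (by lia)]
      exact Red.zero
    rw [harm_eq, faul, show p - 1 = p - 2 + 1 by lia, sum_range_succ, hlast, zero_mul, zero_mul,
      add_zero, add_div, neg_div, sum_div]
    refine congrArg₂ (· + ·) (congrArg _ ?_) ?_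
    · refine sum_congr rfl fun i hi => ?_
      rw [mem_range] at hi
      rw [show p - 2 + 1 - i = p - 3 - i + 2 by lia, pow_add]
      field_simp
    · field_simp
  rw [sum_congr rfl step, sum_add_distrib, ← harmZ, h3, add_zero, sum_neg_distrib, sum_comm]
  simp only [← mul_sum]
  rw [show p - 2 = p - 3 + 1 by lia, sum_range_succ, sum_eq_zero, zero_add]
  · have hc : ((p - 1).choose (p - 3) : ZMod p) = 1 := by
      have h2 := Nat.choose_symm (n := p - 1) (k := 2) (by lia)
      rw [show p - 1 - 2 = p - 3 by lia] at h2
      have h4 := Nat.choose_succ_right_eq (p - 1) 1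
      rw [h2]
      have h5 : (((p - 1).choose 2 * 2 : ℕ) : ZMod p) = (((p - 1) * (p - 2) : ℕ) : ZMod p) := by
        rw [h4, Nat.choose_one_right]; rfl
      push_cast [hp1, natCast_prime_sub (p := p) (k := 2) (by lia)] at h5
      have h20 : (2 : ZMod p) ≠ 0 := by
        exact_mod_cast natCast_zmod_ne_zero (p := p) (k := 2) (by lia) (by lia)
      apply mul_right_cancel₀ h20
      linear_combination h5
    rw [hc, (hb (p - 3) (by lia)).unique hβ]
    simp [hp1]
  · intro i hi
    rw [mem_range] at hi
    rw [sum_zmod_pow (by lia) (by lia), mul_zero]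

theorem Red.sub_prime_pow {x : ℚ} {a : ZMod p} (hx : Red p x a) (m : ℕ) :
    Red p (((x - p) ^ (m + 1) - x ^ (m + 1)) / p) (-(m + 1) * a ^ m) := by
  have hp : (p : ℚ) ≠ 0 := by exact_mod_cast (Fact.out : p.Prime).ne_zero
  induction m with
  | zero => exact (Red.one.neg).of_eq (by field_simp; ring) (by simp)
  | succ m ih =>
    refine (((hx.sub Red.prime).mul ih).sub (hx.pow (m + 1))).of_eq ?_ ?_
    · field_simp; ring
    · push_cast; ring

/-- The power sum with exponent p - 3 is computed modulo p² in two ways, by folding k with p - k and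
2k with p - 2k. Both involve the same half sum T. -/
theorem harmZ_three_half {n : ℕ} (hn : p = 2 * n + 1) (hp5 : 5 < p) {β : ZMod p}
    (hβ : Red p (bernoulli (p - 3)) β) : harmZ p 3 n = -2 * β := by
  have hp : (p : ℚ) ≠ 0 := by exact_mod_cast (Fact.out : p.Prime).ne_zero
  obtain ⟨m, hm⟩ : ∃ m, p = m + 4 := ⟨p - 4, by lia⟩
  have hev : Even (m + 1) := ⟨n - 1, by lia⟩
  rw [show p - 3 = m + 1 by lia] at hβ
  have hS := red_sum_range_pow_div (by lia) hβ
  have hSI : ∑ j ∈ range p, (j : ℚ) ^ (m + 1) = ∑ j ∈ Icc 1 (p - 1), (j : ℚ) ^ (m + 1) := by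
    rw [range_eq_Ico, sum_eq_sum_Ico_succ_bot (by lia), Nat.cast_zero, zero_pow (by lia), zero_add]
    congr 1
  have hpow : ∀ k ≤ p, ((p - k : ℕ) : ℚ) ^ (m + 1) = ((k : ℚ) - p) ^ (m + 1) := fun k hk => by
    rw [Nat.cast_sub hk, ← neg_sub, hev.neg_pow]
  set T : ℚ := ∑ j ∈ Icc 1 n, (j : ℚ) ^ (m + 1) with hT
  have e1 : ∑ j ∈ range p, (j : ℚ) ^ (m + 1) =
      2 * T + p * ∑ j ∈ Icc 1 n, (((j : ℚ) - p) ^ (m + 1) - (j : ℚ) ^ (m + 1)) / p := by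
    rw [hSI, sum_Icc_reflect hn, hT, mul_sum, mul_sum, ← sum_add_distrib]
    refine sum_congr rfl fun k hk => ?_
    rw [mem_Icc] at hk
    rw [hpow k (by lia)]
    field_simp; ring
  have e2 : ∑ j ∈ range p, (j : ℚ) ^ (m + 1) = 2 * 2 ^ (m + 1) * T +
      p * ∑ j ∈ Icc 1 n, ((2 * (j : ℚ) - p) ^ (m + 1) - (2 * (j : ℚ)) ^ (m + 1)) / p := by
    rw [hSI, sum_Icc_even_reflect hn, hT, mul_sum, mul_sum, ← sum_add_distrib]
    refine sum_congr rfl fun k hk => ?_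
    rw [mem_Icc] at hk
    rw [hpow (2 * k) (by lia)]
    push_cast
    rw [mul_pow]
    field_simp; ring
  have r1 : Red p (∑ j ∈ Icc 1 n, (((j : ℚ) - p) ^ (m + 1) - (j : ℚ) ^ (m + 1)) / p)
      (∑ j ∈ Icc 1 n, -((m : ZMod p) + 1) * (j : ZMod p) ^ m) :=
    Red.sum fun j _ => (Red.natCast j).sub_prime_pow m
  have r2 : Red p (∑ j ∈ Icc 1 n, ((2 * (j : ℚ) - p) ^ (m + 1) - (2 * (j : ℚ)) ^ (m + 1)) / p)
      (∑ j ∈ Icc 1 n, -((m : ZMod p) + 1) * (2 * (j : ZMod p)) ^ m) :=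
    Red.sum fun j _ => ((Red.ofNat 2).mul (Red.natCast j)).sub_prime_pow m
  -- The combination 2^(m+1) `e1` - `e2` eliminates T, and one factor p cancels.
  have e3 : (2 ^ (m + 1) - 1) * ((∑ j ∈ range p, (j : ℚ) ^ (m + 1)) / p) =
      2 ^ (m + 1) * (∑ j ∈ Icc 1 n, (((j : ℚ) - p) ^ (m + 1) - (j : ℚ) ^ (m + 1)) / p) -
      ∑ j ∈ Icc 1 n, ((2 * (j : ℚ) - p) ^ (m + 1) - (2 * (j : ℚ)) ^ (m + 1)) / p := by
    rw [← mul_right_inj' hp]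
    calc _ = (2 ^ (m + 1) - 1) * (∑ j ∈ range p, (j : ℚ) ^ (m + 1)) := by field_simp
      _ = 2 ^ (m + 1) * (∑ j ∈ range p, (j : ℚ) ^ (m + 1)) -
          (∑ j ∈ range p, (j : ℚ) ^ (m + 1)) := by ring
      _ = _ := by rw [congrArg (fun x => (2 : ℚ) ^ (m + 1) * x) e1, e2]; ring
  have r3 := (((((Red.ofNat 2).pow (m + 1)).sub Red.one).mul hS).of_eq e3 rfl).unique
    ((((Red.ofNat 2).pow (m + 1)).mul r1).sub r2)
  have h2 : (2 : ZMod p) ≠ 0 := by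
    exact_mod_cast natCast_zmod_ne_zero (p := p) (k := 2) (by lia) (by lia)
  have h3 : (3 : ZMod p) ≠ 0 := by
    exact_mod_cast natCast_zmod_ne_zero (p := p) (k := 3) (by lia) (by lia)
  have hm4 : (m : ZMod p) = -4 := by
    have : ((m + 4 : ℕ) : ZMod p) = 0 := by rw [← hm]; simp
    push_cast at this
    linear_combination this
  have hpm : ∀ x : ZMod p, x ^ m = 1 / x ^ 3 := fun x => by
    have := zmod_pow_prime_sub (p := p) (e := 3) (by lia) x (by lia)
    rwa [show p - 1 - 3 = m by lia] at this
  have h4 : harmZ p 3 n = ∑ j ∈ Icc 1 n, (j : ZMod p) ^ m := sum_congr rfl fun j _ => (hpm j).symm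
  simp only [mul_pow, ← mul_sum] at r3
  rw [← h4, hm4, pow_succ, hpm 2] at r3
  field_simp at r3
  apply mul_left_cancel₀ h3
  linear_combination -r3

theorem natCast_prime_ne_zero : (p : ℚ) ≠ 0 := by
  exact_mod_cast (Fact.out : p.Prime).ne_zero

theorem zmod_ofNat_ne_zero {p k : ℕ} [k.AtLeastTwo] (h : k < p) :
    (OfNat.ofNat k : ZMod p) ≠ 0 := by
  have h2 : 2 ≤ k := Nat.AtLeastTwo.prop
  have := natCast_zmod_ne_zero (by lia) h
  exact_mod_cast this

theorem zmod_two_three_five_ne_zero (hp5 : 5 < p) :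
    (2 : ZMod p) ≠ 0 ∧ (3 : ZMod p) ≠ 0 ∧ (5 : ZMod p) ≠ 0 :=
  ⟨zmod_ofNat_ne_zero (by lia), zmod_ofNat_ne_zero (by lia), zmod_ofNat_ne_zero hp5⟩

theorem red_natCast_inv_pow {k : ℕ} (s : ℕ) (h1 : 1 ≤ k) (h2 : k < p) :
    Red p (1 / (k : ℚ) ^ s) (1 / (k : ZMod p) ^ s) :=
  Red.one.div ((Red.natCast k).pow s) (pow_ne_zero _ (natCast_zmod_ne_zero h1 h2))

theorem sum_harmZ_div_sq_half {n : ℕ} (hn : p = 2 * n + 1) (hp5 : 5 < p) {β : ZMod p}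
    (hβ : Red p (bernoulli (p - 3)) β) :
    2 * ∑ k ∈ Icc 1 n, harmZ p 1 k / (k : ZMod p) ^ 2 = -β := by
  have h := sum_harmZ_div_sq hn hp5 hβ
  rw [sum_Icc_reflect hn] at h
  have h2 : ∑ k ∈ Icc 1 n, (harmZ p 1 k / (k : ZMod p) ^ 2 +
      harmZ p 1 (p - k) / ((p - k : ℕ) : ZMod p) ^ 2) =
      2 * ∑ k ∈ Icc 1 n, harmZ p 1 k / (k : ZMod p) ^ 2 - harmZ p 3 n := by
    rw [harmZ, mul_sum, ← sum_sub_distrib]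
    refine sum_congr rfl fun k hk => ?_
    rw [mem_Icc] at hk
    have hk0 : (k : ZMod p) ≠ 0 := natCast_zmod_ne_zero hk.1 (by lia)
    rw [harmZ_one_prime_sub hn hk.1 (by lia), natCast_prime_sub (by lia)]
    field_simp
    ring
  rw [h2, harmZ_three_half hn hp5 hβ] at h
  linear_combination h

theorem sum_harmZ_two_mul_div_sq {n : ℕ} (hn : p = 2 * n + 1) (hp5 : 5 < p) {β : ZMod p}
    (hβ : Red p (bernoulli (p - 3)) β) :
    2 * ∑ k ∈ Icc 1 n, harmZ p 1 (2 * k) / (k : ZMod p) ^ 2 = 3 * β := by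
  obtain ⟨t2, -, -⟩ := zmod_two_three_five_ne_zero hp5
  have h := sum_harmZ_div_sq hn hp5 hβ
  rw [sum_Icc_even_reflect hn] at h
  have h2 : 8 * ∑ k ∈ Icc 1 n, (harmZ p 1 (2 * k) / ((2 * k : ℕ) : ZMod p) ^ 2 +
      harmZ p 1 (p - 2 * k) / ((p - 2 * k : ℕ) : ZMod p) ^ 2) =
      4 * ∑ k ∈ Icc 1 n, harmZ p 1 (2 * k) / (k : ZMod p) ^ 2 - harmZ p 3 n := by
    rw [harmZ, mul_sum, mul_sum, ← sum_sub_distrib]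
    refine sum_congr rfl fun k hk => ?_
    rw [mem_Icc] at hk
    have hk0 : (k : ZMod p) ≠ 0 := natCast_zmod_ne_zero hk.1 (by lia)
    rw [harmZ_one_prime_sub hn (by lia) (by lia), natCast_prime_sub (by lia)]
    push_cast
    field_simp
    ring
  rw [h, harmZ_three_half hn hp5 hβ] at h2
  apply mul_left_cancel₀ t2
  linear_combination -h2

/-- The residue of `∑ j ≤ k, 1 / (2 j - 1) ^ s` modulo `p`. -/
def oddHarmZ (p : ℕ) [Fact p.Prime] (s k : ℕ) : ZMod p :=
  ∑ j ∈ Icc 1 k, 1 / (2 * (j : ZMod p) - 1) ^ s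

theorem oddHarmZ_one (k : ℕ) :
    oddHarmZ p 1 k = harmZ p 1 (2 * k) - harmZ p 1 k / 2 := by
  induction k with
  | zero => simp [oddHarmZ]
  | succ k ih =>
    rw [oddHarmZ, sum_Icc_succ_top (by lia), ← oddHarmZ, ih, show 2 * (k + 1) = 2 * k + 1 + 1 by lia,
      harmZ_succ, harmZ_succ, harmZ_succ]
    push_cast
    have e1 : 2 * ((k : ZMod p) + 1) - 1 = 2 * k + 1 := by ring
    have e2 : 2 * (k : ZMod p) + 1 + 1 = (k + 1) * 2 := by ring
    rw [e1, e2]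
    simp only [pow_one, mul_inv, div_eq_mul_inv]
    ring

theorem sum_oddHarmZ_div_sq {n : ℕ} (hn : p = 2 * n + 1) (hp5 : 5 < p) {β : ZMod p}
    (hβ : Red p (bernoulli (p - 3)) β) :
    ∑ k ∈ Icc 1 n, oddHarmZ p 1 k / (k : ZMod p) ^ 2 = 7 / 4 * β := by
  have h1 := sum_harmZ_div_sq_half hn hp5 hβ
  have h2 := sum_harmZ_two_mul_div_sq hn hp5 hβ
  have t2 := (zmod_two_three_five_ne_zero hp5).1
  have t4 : (4 : ZMod p) = 2 * 2 := by norm_num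
  simp only [oddHarmZ_one, sub_div, sum_sub_distrib]
  simp only [div_right_comm _ (2 : ZMod p), ← sum_div]
  rw [t4]
  field_simp
  linear_combination 2 * h2 - h1

/-- Put (-1)^k C(p-1,k) ≡ 1 - p H_k (mod p²) into `sum_choose_div_sq` at N = p - 1. The square of
H_{p-1} drops out, since H_{p-1} ≡ 0 (mod p). -/
theorem red_harm_two_div {n : ℕ} (hn : p = 2 * n + 1) (hp5 : 5 < p) {β : ZMod p}
    (hβ : Red p (bernoulli (p - 3)) β) : Red p (harm 2 (p - 1) / p) (2 / 3 * β) := by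
  have hp := natCast_prime_ne_zero (p := p)
  obtain ⟨t2, t3, -⟩ := zmod_two_three_five_ne_zero hp5
  have h1 := red_harm (p := p) 1 (by lia : p - 1 < p)
  rw [harmZ_prime_sub_one_of_odd hn (by decide)] at h1
  obtain ⟨c, hc⟩ := h1.div_prime
  have hX : Red p (∑ k ∈ Icc 1 (p - 1),
      ((-1 : ℚ) ^ k * ((p - 1).choose k : ℚ) - 1) / p * (1 / (k : ℚ) ^ 2))
      (∑ k ∈ Icc 1 (p - 1), -harmZ p 1 k * (1 / (k : ZMod p) ^ 2)) := by
    refine Red.sum fun k hk => ?_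
    rw [mem_Icc] at hk
    refine Red.mul ?_ (red_natCast_inv_pow 2 hk.1 (by lia))
    have h2 : ((p - 1 : ℕ) : ℚ) + 1 = p := by
      rw [Nat.cast_sub (by lia)]; simp
    rw [neg_one_pow_mul_choose hk.2, h2, harmZ, ← sum_neg_distrib]
    refine Red.prod_one_add Red.prime hp fun j hj => ?_
    rw [mem_Icc] at hj
    exact (red_natCast_inv_pow 1 hj.1 (by lia)).neg
  have h3 := sum_choose_div_sq (p - 1)
  have h4 : ∑ k ∈ Icc 1 (p - 1), (-1 : ℚ) ^ k * ((p - 1).choose k : ℚ) / (k : ℚ) ^ 2 =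
      p * (∑ k ∈ Icc 1 (p - 1),
      ((-1 : ℚ) ^ k * ((p - 1).choose k : ℚ) - 1) / p * (1 / (k : ℚ) ^ 2)) + harm 2 (p - 1) := by
    rw [harm, mul_sum, ← sum_add_distrib]
    refine sum_congr rfl fun k _ => ?_
    field_simp
    ring
  rw [h4] at h3
  set S := ∑ k ∈ Icc 1 (p - 1),
    ((-1 : ℚ) ^ k * ((p - 1).choose k : ℚ) - 1) / p * (1 / (k : ℚ) ^ 2)
  clear_value S
  refine (((Red.ofNat 2).div (Red.ofNat 3) t3).mul (hX.neg.sub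
    ((h1.mul hc).div (Red.ofNat 2) t2))).of_eq ?_ ?_
  · field_simp
    linear_combination -2 * h3
  · rw [← sum_harmZ_div_sq hn hp5 hβ, ← sum_neg_distrib, zero_mul, zero_div, sub_zero]
    congr 1
    refine sum_congr rfl fun k _ => ?_
    ring

/-- Folding k with p - k gives twice the half sum plus a multiple of p whose residue is 2 `harmZ p 3
n`. -/
theorem red_harm_two_half_div {n : ℕ} (hn : p = 2 * n + 1) (hp5 : 5 < p) {β : ZMod p}
    (hβ : Red p (bernoulli (p - 3)) β) : Red p (harm 2 n / p) (7 / 3 * β) := by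
  have hp := natCast_prime_ne_zero (p := p)
  obtain ⟨t2, t3, -⟩ := zmod_two_three_five_ne_zero hp5
  have h1 : Red p (∑ k ∈ Icc 1 n, (2 * (k : ℚ) - p) / ((k : ℚ) ^ 2 * ((p - k : ℕ) : ℚ) ^ 2))
      (∑ k ∈ Icc 1 n, (2 * (k : ZMod p) - 0) /
        ((k : ZMod p) ^ 2 * ((p - k : ℕ) : ZMod p) ^ 2)) := by
    refine Red.sum fun k hk => ?_
    rw [mem_Icc] at hk
    exact (((Red.ofNat 2).mul (Red.natCast k)).sub Red.prime).div
      (((Red.natCast k).pow 2).mul ((Red.natCast _).pow 2))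
      (mul_ne_zero (pow_ne_zero _ (natCast_zmod_ne_zero hk.1 (by lia)))
        (pow_ne_zero _ (natCast_zmod_ne_zero (by lia) (by lia))))
  have h2 : harm 2 (p - 1) = 2 * harm 2 n + p *
      ∑ k ∈ Icc 1 n, (2 * (k : ℚ) - p) / ((k : ℚ) ^ 2 * ((p - k : ℕ) : ℚ) ^ 2) := by
    rw [harm, sum_Icc_reflect hn, harm, mul_sum, mul_sum, ← sum_add_distrib]
    refine sum_congr rfl fun k hk => ?_
    rw [mem_Icc] at hk
    have hk0 : (k : ℚ) ≠ 0 := by exact_mod_cast (by lia : k ≠ 0)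
    have hk1 : ((p - k : ℕ) : ℚ) ≠ 0 := by exact_mod_cast (by lia : p - k ≠ 0)
    rw [Nat.cast_sub (by lia)] at *
    field_simp
    ring
  have h3 : ∑ k ∈ Icc 1 n, (2 * (k : ZMod p) - 0) /
        ((k : ZMod p) ^ 2 * ((p - k : ℕ) : ZMod p) ^ 2) = 2 * harmZ p 3 n := by
    rw [harmZ, mul_sum]
    refine sum_congr rfl fun k hk => ?_
    rw [mem_Icc] at hk
    have hk0 : (k : ZMod p) ≠ 0 := natCast_zmod_ne_zero hk.1 (by lia)
    rw [natCast_prime_sub (by lia)]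
    field_simp
    ring
  rw [h3, harmZ_three_half hn hp5 hβ] at h1
  refine (((red_harm_two_div hn hp5 hβ).sub h1).div (Red.ofNat 2) t2).of_eq ?_ ?_
  · rw [h2]; field_simp; ring
  · field_simp; ring

theorem two_mul_sub_one_ne_zero {n j : ℕ} (hn : p = 2 * n + 1) (h1 : 1 ≤ j) (h2 : j ≤ n) :
    2 * (j : ZMod p) - 1 ≠ 0 := by
  have h := natCast_zmod_ne_zero (p := p) (k := 2 * j - 1) (by lia) (by lia)
  rw [Nat.cast_sub (by lia)] at h
  simpa using h

/-! ### The Apéry-like sums -/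

theorem red_dualAperySum_half_div {n : ℕ} (hn : p = 2 * n + 1) (hp5 : 5 < p) {β : ZMod p}
    (hβ : Red p (bernoulli (p - 3)) β) : Red p (dualAperySum n / p) (56 / 15 * β) := by
  have hp := natCast_prime_ne_zero (p := p)
  obtain ⟨t2, t3, t5⟩ := zmod_two_three_five_ne_zero hp5
  have hX : Red p (∑ k ∈ Icc 1 n, ((-1 : ℚ) ^ k * chooseRatio n k - 1) / p * (1 / (k : ℚ) ^ 2))
      (∑ k ∈ Icc 1 n, (2 * oddHarmZ p 1 k) * (1 / (k : ZMod p) ^ 2)) := by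
    refine Red.sum fun k hk => ?_
    rw [mem_Icc] at hk
    refine Red.mul ?_ (red_natCast_inv_pow 2 hk.1 (by lia))
    rw [neg_one_pow_mul_chooseRatio_half hn hk.2, oddHarmZ, mul_sum]
    refine Red.prod_one_add Red.prime hp fun j hj => ?_
    rw [mem_Icc] at hj
    have hj0 := two_mul_sub_one_ne_zero hn hj.1 (hj.2.trans hk.2)
    refine ((Red.ofNat 2).div ((((Red.ofNat 2).mul (Red.natCast j)).sub Red.one).sub
      Red.prime) (by rwa [sub_zero])).of_eq rfl (by rw [sub_zero]; ring)
  have h1 : ∑ k ∈ Icc 1 n, (2 * oddHarmZ p 1 k) * (1 / (k : ZMod p) ^ 2) = 7 / 2 * β := by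
    have := sum_oddHarmZ_div_sq hn hp5 hβ
    have t4 : (4 : ZMod p) = 2 * 2 := by norm_num
    rw [t4] at this
    rw [show 7 / 2 * β = 2 * (7 / (2 * 2) * β) by field_simp, ← this, mul_sum]
    refine sum_congr rfl fun k _ => ?_
    ring
  have h2 := dualAperySum_eq n
  have h3 : chooseRatioSum n = harm 2 n +
      p * ∑ k ∈ Icc 1 n, ((-1 : ℚ) ^ k * chooseRatio n k - 1) / p * (1 / (k : ℚ) ^ 2) := by
    rw [chooseRatioSum, harm, mul_sum, ← sum_add_distrib]
    refine sum_congr rfl fun k _ => ?_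
    field_simp
    ring
  rw [h1] at hX
  set S := ∑ k ∈ Icc 1 n, ((-1 : ℚ) ^ k * chooseRatio n k - 1) / p * (1 / (k : ℚ) ^ 2)
  clear_value S
  refine (((Red.ofNat 2).div (Red.ofNat 5) t5).mul ((red_harm_two_half_div hn hp5 hβ).add
    ((Red.ofNat 2).mul hX))).of_eq ?_ ?_
  · rw [h3] at h2
    field_simp
    linear_combination -2 * h2
  · have : (15 : ZMod p) = 3 * 5 := by norm_num
    rw [this]
    field_simp
    ring

/-- The first factor is p/(p-1), and no later factor contains p. Consequently at N = p - 1 the sum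
`chooseRatioSum` is p times a sum with residue `harmZ p 3 (p - 1)`, which is 0. -/
theorem red_chooseRatio_prime_sub_one_div (hp5 : 5 < p) {k : ℕ} (h1 : 1 ≤ k) (hk : k < p) :
    Red p (chooseRatio ((p - 1 : ℕ) : ℚ) k / p) ((-1) ^ k / k) := by
  have hp := natCast_prime_ne_zero (p := p)
  have e0 : ((p - 1 : ℕ) : ℚ) = p - 1 := by rw [Nat.cast_sub (by lia)]; simp
  rw [e0]
  induction k, h1 using Nat.le_induction with
  | base =>
    have := (Red.one (p := p)).div (Red.prime.sub Red.one) (by simp)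
    refine this.of_eq ?_ (by simp)
    simp [chooseRatio]
    field_simp
  | succ k hk1 ih =>
    have hk0 : (k : ZMod p) ≠ 0 := natCast_zmod_ne_zero hk1 (by lia)
    have hk2 : (k : ZMod p) + 1 ≠ 0 := by
      exact_mod_cast natCast_zmod_ne_zero (p := p) (k := k + 1) (by lia) (by lia)
    have h := (ih (by lia)).mul ((Red.prime.add (Red.natCast k)).div
      ((Red.prime.sub (Red.natCast k)).sub Red.one)
      (by rw [zero_sub, ← neg_add']; exact neg_ne_zero.2 hk2))
    refine h.of_eq ?_ ?_
    · rw [chooseRatio_succ]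
      ring_nf
    · rw [zero_add, zero_sub, ← neg_add']
      push_cast
      rw [pow_succ]
      field_simp

theorem red_dualAperySum_div {n : ℕ} (hn : p = 2 * n + 1) (hp5 : 5 < p) {β : ZMod p}
    (hβ : Red p (bernoulli (p - 3)) β) : Red p (dualAperySum (p - 1) / p) (-(4 / 15) * β) := by
  have hp := natCast_prime_ne_zero (p := p)
  obtain ⟨t2, t3, t5⟩ := zmod_two_three_five_ne_zero hp5
  have hW : Red p (chooseRatioSum (p - 1) / p) (harmZ p 3 (p - 1)) := by
    rw [chooseRatioSum, sum_div, harmZ]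
    refine Red.sum fun k hk => ?_
    rw [mem_Icc] at hk
    have hk0 : (k : ZMod p) ≠ 0 := natCast_zmod_ne_zero hk.1 (by lia)
    refine (((Red.one.neg.pow k).div ((Red.natCast k).pow 2) (pow_ne_zero _ hk0)).mul
      (red_chooseRatio_prime_sub_one_div hp5 hk.1 (by lia))).of_eq (by ring) ?_
    have : (-1 : ZMod p) ^ k * (-1) ^ k = 1 := by rw [← mul_pow]; simp
    field_simp
    rw [sq, this]
  rw [harmZ_prime_sub_one_of_odd hn (by decide)] at hW
  have h2 := dualAperySum_eq (p - 1)
  refine (((Red.ofNat 2).div (Red.ofNat 5) t5).mul ((red_harm_two_div hn hp5 hβ).neg.add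
    ((Red.ofNat 2).mul hW))).of_eq ?_ ?_
  · field_simp
    linear_combination -2 * h2
  · have : (15 : ZMod p) = 3 * 5 := by norm_num
    rw [this]
    field_simp
    ring

theorem choose_two_mul_zmod_ne_zero {n k : ℕ} (hn : p = 2 * n + 1) (hk : k ≤ n) :
    ((2 * k).choose k : ZMod p) ≠ 0 := by
  intro h
  rw [ZMod.natCast_eq_zero_iff] at h
  have h1 : p ∣ (2 * k).factorial := h.trans (Dvd.intro _ (by
    rw [← mul_assoc]; exact Nat.choose_mul_factorial_mul_factorial (by lia)))
  rw [(Fact.out : p.Prime).dvd_factorial] at h1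
  lia

theorem choose_two_mul_succ_zmod (k : ℕ) :
    ((2 * (k + 1)).choose (k + 1) : ZMod p) * (k + 1) =
      2 * (2 * k + 1) * ((2 * k).choose k : ZMod p) := by
  have := Nat.succ_mul_centralBinom_succ k
  simp only [Nat.centralBinom_eq_two_mul_choose] at this
  have h : (((k + 1) * (2 * (k + 1)).choose (k + 1) : ℕ) : ZMod p) =
    ((2 * (2 * k + 1) * (2 * k).choose k : ℕ) : ZMod p) := by rw [this]
  push_cast at h
  linear_combination h

theorem red_choose_two_mul_prime_sub_div {n : ℕ} (hn : p = 2 * n + 1) (hp5 : 5 < p) {j : ℕ}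
    (h1 : 1 ≤ j) (hj : j ≤ n) :
    Red p (((2 * (p - j)).choose (p - j) : ℚ) / p)
      (-2 / (j * ((2 * j).choose j : ZMod p))) := by
  have hp := natCast_prime_ne_zero (p := p)
  have t2 := (zmod_two_three_five_ne_zero hp5).1
  induction j, h1 using Nat.le_induction with
  | base =>
    have h2 := Nat.add_one_mul_choose_eq (2 * (p - 1)) (p - 1)
    rw [show p - 1 + 1 = p by lia, show 2 * (p - 1) + 1 = p + (p - 1) by lia] at h2
    have h3 : (((p + (p - 1)) * (2 * (p - 1)).choose (p - 1) : ℕ) : ℚ) =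
        (((p + (p - 1)).choose p * p : ℕ) : ℚ) := by rw [h2]
    have h4 : ((p + (p - 1) : ℕ) : ZMod p) = -1 := by
      have := natCast_prime_sub (p := p) (k := 1) (by lia)
      push_cast [this]; simp
    -- Lucas' theorem for 2p - 1 = p + (p-1) over p.
    have h5 : ((p + (p - 1)).choose p : ZMod p) = 1 := by
      have h := Choose.choose_modEq_choose_mod_mul_choose_div_nat (n := p + (p - 1)) (k := p) (p := p)
      rw [← ZMod.natCast_eq_natCast_iff] at h
      rw [h, Nat.add_mod_left, Nat.mod_self, Nat.add_div_left _ (by lia),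
        Nat.div_eq_of_lt (by lia : p - 1 < p), Nat.div_self (by lia)]
      simp
    refine ((Red.natCast ((p + (p - 1)).choose p)).div (Red.natCast (p + (p - 1)))
      (by rw [h4]; simp)).of_eq ?_ ?_
    · have : ((p + (p - 1) : ℕ) : ℚ) ≠ 0 := by exact_mod_cast (by lia : p + (p - 1) ≠ 0)
      rw [div_eq_div_iff this hp]
      rw [Nat.cast_mul, Nat.cast_mul] at h3
      linear_combination -h3
    · rw [h4, h5]
      simp
      field_simp
  | succ j hj1 ih =>
    have hj0 : (j : ZMod p) ≠ 0 := natCast_zmod_ne_zero hj1 (by lia)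
    have hj2 : (j : ZMod p) + 1 ≠ 0 := by
      exact_mod_cast natCast_zmod_ne_zero (p := p) (k := j + 1) (by lia) (by lia)
    have hj3 : 2 * (j : ZMod p) + 1 ≠ 0 := by
      exact_mod_cast natCast_zmod_ne_zero (p := p) (k := 2 * j + 1) (by lia) (by lia)
    have hc := choose_two_mul_zmod_ne_zero hn (by lia : j ≤ n)
    have h2 := choose_two_mul_succ_zmod (p := p) j
    have h3 := choose_two_mul_succ (p - (j + 1))
    rw [show p - (j + 1) + 1 = p - j by lia] at h3
    have h4 : ((p - (j + 1) : ℕ) : ℚ) = p - j - 1 := by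
      rw [Nat.cast_sub (by lia)]; push_cast; ring
    rw [h4] at h3
    have hj4 : 2 * ((p : ℚ) - j - 1) + 1 ≠ 0 := by
      rw [← h4]; positivity
    have hd : (2 : ZMod p) * (2 * (0 - j - 1) + 1) ≠ 0 := by
      rw [show (2 : ZMod p) * (2 * (0 - j - 1) + 1) = -(2 * (2 * j + 1)) by ring]
      exact neg_ne_zero.2 (mul_ne_zero t2 hj3)
    refine ((ih (by lia)).mul ((Red.prime.sub (Red.natCast j)).div
      ((Red.ofNat 2).mul ((((Red.ofNat 2).mul ((Red.prime.sub (Red.natCast j)).sub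
        Red.one))).add Red.one)) hd)).of_eq ?_ ?_
    · field_simp
      linear_combination h3
    · rw [← eq_div_iff hj2] at h2
      push_cast
      rw [h2]
      rw [show (2 : ZMod p) * (2 * (0 - j - 1) + 1) = -(2 * (2 * j + 1)) by ring]
      field_simp
      ring

/-- The residue of `aperySum n` modulo `p`, for `2 * n < p`. -/
def aperySumZ (p : ℕ) [Fact p.Prime] (n : ℕ) : ZMod p :=
  ∑ k ∈ Icc 1 n, (-1) ^ k / ((k : ZMod p) ^ 3 * ((2 * k).choose k : ZMod p))

theorem red_aperySum {n : ℕ} (hn : p = 2 * n + 1) : Red p (aperySum n) (aperySumZ p n) := by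
  refine Red.sum fun k hk => ?_
  rw [mem_Icc] at hk
  exact (Red.one.neg.pow k).div (((Red.natCast k).pow 3).mul (Red.natCast _))
    (mul_ne_zero (pow_ne_zero _ (natCast_zmod_ne_zero hk.1 (by lia)))
      (choose_two_mul_zmod_ne_zero hn hk.2))

/-- Reflecting the upper half of the dual sum inverts the central binomial coefficients. The sign
from (-1)^(p-j) cancels that of -2/(j C(2j,j)), so 2 `aperySumZ p n` = (-4/15 - 56/15) β. -/
theorem aperySumZ_half {n : ℕ} (hn : p = 2 * n + 1) (hp5 : 5 < p) {β : ZMod p}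
    (hβ : Red p (bernoulli (p - 3)) β) : aperySumZ p n = -2 * β := by
  obtain ⟨t2, t3, t5⟩ := zmod_two_three_five_ne_zero hp5
  have h1 : Red p (dualAperySum (p - 1) / p - dualAperySum n / p) (2 * aperySumZ p n) := by
    have e : dualAperySum (p - 1) / p - dualAperySum n / p = ∑ j ∈ Icc 1 n,
        (-1 : ℚ) ^ (p - j) / ((p - j : ℕ) : ℚ) ^ 2 *
          (((2 * (p - j)).choose (p - j) : ℚ) / p) := by
      rw [dualAperySum, sum_Icc_eq_add_upper hn, sum_Icc_split_reflect hn, ← dualAperySum,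
        ← sub_div, add_sub_cancel_left, sum_div]
      exact sum_congr rfl fun k _ => mul_div_assoc _ _ _
    rw [e, aperySumZ, mul_sum]
    refine Red.sum fun j hj => ?_
    rw [mem_Icc] at hj
    have hj0 : (j : ZMod p) ≠ 0 := natCast_zmod_ne_zero hj.1 (by lia)
    have hc := choose_two_mul_zmod_ne_zero hn hj.2
    refine (((Red.one.neg.pow (p - j)).div ((Red.natCast (p - j)).pow 2)
      (pow_ne_zero _ (natCast_zmod_ne_zero (by lia) (by lia)))).mul
      (red_choose_two_mul_prime_sub_div hn hp5 hj.1 hj.2)).of_eq rfl ?_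
    have h2 : (-1 : ZMod p) ^ (p - j) = -(-1) ^ j := by
      have h : (-1 : ZMod p) ^ (p - j) * (-1) ^ j = -1 := by
        rw [← pow_add, show p - j + j = p by lia]
        exact Odd.neg_one_pow ⟨n, hn⟩
      have h' : (-1 : ZMod p) ^ j * (-1) ^ j = 1 := by rw [← mul_pow]; simp
      linear_combination (-1 : ZMod p) ^ j * h - (-1) ^ (p - j) * h'
    rw [natCast_prime_sub (by lia), h2]
    field_simp
  have h2 := h1.unique ((red_dualAperySum_div hn hp5 hβ).sub (red_dualAperySum_half_div hn hp5 hβ))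
  have t15 : (15 : ZMod p) = 3 * 5 := by norm_num
  apply mul_left_cancel₀ t2
  rw [h2, t15]
  field_simp
  ring

/-! ### Sums with squared central binomial coefficients -/

theorem red_prod_one_sub_sq {n k : ℕ} (hn : p = 2 * n + 1) (hk : k ≤ n) :
    Red p ((∏ j ∈ Icc 1 k, (1 + (p : ℚ) ^ 2 * -(1 / (2 * (j : ℚ) - 1) ^ 2)) - 1) / (p : ℚ) ^ 2)
      (-oddHarmZ p 2 k) := by
  have hp := natCast_prime_ne_zero (p := p)
  rw [oddHarmZ, ← sum_neg_distrib]
  refine Red.prod_one_add ((Red.prime.pow 2).of_eq rfl (by simp)) (pow_ne_zero _ hp) fun j hj => ?_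
  rw [mem_Icc] at hj
  exact (Red.one.div ((((Red.ofNat 2).mul (Red.natCast j)).sub Red.one).pow 2)
    (pow_ne_zero _ (two_mul_sub_one_ne_zero hn hj.1 (hj.2.trans hk)))).neg

/-- The residue of `choose (2 k) k ^ 2 / 16 ^ k` modulo `p`. -/
def chooseSqZ (p : ℕ) [Fact p.Prime] (k : ℕ) : ZMod p := ((2 * k).choose k : ZMod p) ^ 2 / 16 ^ k

theorem zmod_sixteen_ne_zero (hp5 : 5 < p) : (16 : ZMod p) ≠ 0 := by
  have t2 := (zmod_two_three_five_ne_zero hp5).1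
  rw [show (16 : ZMod p) = 2 ^ 4 by norm_num]
  exact pow_ne_zero _ t2

theorem chooseSqZ_ne_zero {n k : ℕ} (hn : p = 2 * n + 1) (hp5 : 5 < p) (hk : k ≤ n) :
    chooseSqZ p k ≠ 0 :=
  div_ne_zero (pow_ne_zero _ (choose_two_mul_zmod_ne_zero hn hk))
    (pow_ne_zero _ (zmod_sixteen_ne_zero hp5))

theorem red_choose_sq (hp5 : 5 < p) (k : ℕ) :
    Red p (((2 * k).choose k : ℚ) ^ 2 / 16 ^ k) (chooseSqZ p k) :=
  ((Red.natCast _).pow 2).div ((Red.ofNat 16).pow k) (pow_ne_zero _ (zmod_sixteen_ne_zero hp5))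

theorem red_legendreTerm_half {n k : ℕ} (hn : p = 2 * n + 1) (hp5 : 5 < p) (hk : k ≤ n) :
    Red p (legendreTerm n k) (chooseSqZ p k) := by
  have hp := natCast_prime_ne_zero (p := p)
  rw [legendreTerm_half hn]
  refine ((red_choose_sq hp5 k).mul ((((Red.prime.pow 2).mul
    (red_prod_one_sub_sq hn hk))).add Red.one)).of_eq ?_ (by simp)
  field_simp
  ring

theorem red_sum_one_div_choose_sq {n : ℕ} (hn : p = 2 * n + 1) (hp5 : 5 < p) :
    Red p (∑ k ∈ Icc 1 n, (16 : ℚ) ^ k / ((k : ℚ) ^ 3 * ((2 * k).choose k : ℚ) ^ 2))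
      (∑ k ∈ Icc 1 n, 1 / ((k : ZMod p) ^ 3 * chooseSqZ p k)) := by
  refine Red.sum fun k hk => ?_
  rw [mem_Icc] at hk
  have hk0 : (k : ZMod p) ≠ 0 := natCast_zmod_ne_zero hk.1 (by lia)
  refine (Red.one.div (((Red.natCast k).pow 3).mul (red_choose_sq hp5 k))
    (mul_ne_zero (pow_ne_zero _ hk0) (chooseSqZ_ne_zero hn hp5 hk.2))).of_eq ?_ rfl
  have := choose_two_mul_ne_zero k
  field_simp

theorem sum_one_div_chooseSqZ {n : ℕ} (hn : p = 2 * n + 1) (hp5 : 5 < p) {β : ZMod p}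
    (hβ : Red p (bernoulli (p - 3)) β) :
    ∑ k ∈ Icc 1 n, 1 / ((k : ZMod p) ^ 3 * chooseSqZ p k) = -14 * β := by
  have h1 : Red p (∑ k ∈ Icc 1 n, 1 / ((k : ℚ) ^ 3 * legendreTerm n k))
      (∑ k ∈ Icc 1 n, 1 / ((k : ZMod p) ^ 3 * chooseSqZ p k)) := by
    refine Red.sum fun k hk => ?_
    rw [mem_Icc] at hk
    exact Red.one.div (((Red.natCast k).pow 3).mul (red_legendreTerm_half hn hp5 hk.2))
      (mul_ne_zero (pow_ne_zero _ (natCast_zmod_ne_zero hk.1 (by lia)))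
        (chooseSqZ_ne_zero hn hp5 hk.2))
  rw [sum_one_div_legendreTerm] at h1
  have h2 := ((Red.ofNat 2).mul (red_harm 3 (by lia : n < p))).add
    ((Red.ofNat 5).mul (red_aperySum hn))
  rw [h1.unique h2, harmZ_three_half hn hp5 hβ, aperySumZ_half hn hp5 hβ]
  ring

theorem red_sum_choose_sq_upper {n : ℕ} (hn : p = 2 * n + 1) (hp5 : 5 < p) :
    Red p (-(4 / (p : ℚ) ^ 2) * ∑ k ∈ Icc (n + 1) (p - 1),
        ((2 * k).choose k : ℚ) ^ 2 / ((k : ℚ) * 16 ^ k))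
      (∑ k ∈ Icc 1 n, 1 / ((k : ZMod p) ^ 3 * chooseSqZ p k)) := by
  have hp := natCast_prime_ne_zero (p := p)
  have t2 := (zmod_two_three_five_ne_zero hp5).1
  have t16 := zmod_sixteen_ne_zero hp5
  rw [sum_Icc_split_reflect hn, mul_sum]
  refine Red.sum fun j hj => ?_
  rw [mem_Icc] at hj
  have hj0 : (j : ZMod p) ≠ 0 := natCast_zmod_ne_zero hj.1 (by lia)
  have hc := choose_two_mul_zmod_ne_zero hn hj.2
  refine ((Red.ofNat 4).neg.mul (((red_choose_two_mul_prime_sub_div hn hp5 hj.1 hj.2).pow 2).div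
    ((Red.natCast (p - j)).mul ((Red.ofNat 16).pow (p - j)))
    (mul_ne_zero (natCast_zmod_ne_zero (by lia) (by lia)) (pow_ne_zero _ t16)))).of_eq ?_ ?_
  · have : ((p - j : ℕ) : ℚ) ≠ 0 := by exact_mod_cast (by lia : p - j ≠ 0)
    field_simp
  -- Fermat: 16^p = 16.
  · have h16 : (16 : ZMod p) ^ (p - j) = 16 / 16 ^ j := by
      rw [eq_div_iff (pow_ne_zero _ t16), ← pow_add, show p - j + j = p by lia, ZMod.pow_card]
    rw [h16, natCast_prime_sub (by lia), chooseSqZ]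
    have : (16 : ZMod p) = 4 * 2 ^ 2 := by norm_num
    field_simp
    linear_combination -this

/-- This is the derivative identity divided by p, because `logDerivSum n k` is p times a quantity
with residue -4 `oddHarmZ p 2 k`. -/
theorem sum_chooseSqZ_mul_oddHarmZ {n : ℕ} (hn : p = 2 * n + 1) (hp5 : 5 < p) {β : ZMod p}
    (hβ : Red p (bernoulli (p - 3)) β) :
    ∑ k ∈ Icc 1 n, chooseSqZ p k / k * oddHarmZ p 2 k = -(7 / 2) * β := by
  have hp := natCast_prime_ne_zero (p := p)
  obtain ⟨t2, t3, t5⟩ := zmod_two_three_five_ne_zero hp5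
  have h1 : Red p ((∑ k ∈ Icc 1 n, legendreTerm n k / k * logDerivSum n k) / p)
      (∑ k ∈ Icc 1 n, chooseSqZ p k / k * (-4 * oddHarmZ p 2 k)) := by
    rw [sum_div]
    refine Red.sum fun k hk => ?_
    rw [mem_Icc] at hk
    rw [logDerivSum_half hn hk.2, mul_div_assoc, mul_div_cancel_left₀ _ hp]
    refine ((red_legendreTerm_half hn hp5 hk.2).div (Red.natCast k)
      (natCast_zmod_ne_zero hk.1 (by lia))).mul ?_
    rw [oddHarmZ, mul_sum]
    refine Red.sum fun j hj => ?_
    rw [mem_Icc] at hj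
    have hj0 := two_mul_sub_one_ne_zero hn hj.1 (hj.2.trans hk.2)
    refine ((Red.ofNat 4).div ((Red.prime.pow 2).sub
      ((((Red.ofNat 2).mul (Red.natCast j)).sub Red.one).pow 2)) ?_).of_eq rfl ?_
    · rw [zero_pow two_ne_zero, zero_sub]
      exact neg_ne_zero.2 (pow_ne_zero _ hj0)
    · rw [zero_pow two_ne_zero, zero_sub]
      field_simp
  rw [sum_legendreTerm_div_mul_logDerivSum] at h1
  have h2 := ((Red.ofNat 2).mul (red_harm_two_half_div hn hp5 hβ)).add
    (((Red.ofNat 5).div (Red.ofNat 2) t2).mul (red_dualAperySum_half_div hn hp5 hβ))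
  have h3 := h1.unique (h2.of_eq (by ring) rfl)
  have t15 : (15 : ZMod p) = 3 * 5 := by norm_num
  have t4 : (4 : ZMod p) = 2 * 2 := by norm_num
  simp only [mul_left_comm _ (-4 : ZMod p), ← mul_sum] at h3
  have h4 : (4 : ZMod p) ≠ 0 := by rw [t4]; exact mul_ne_zero t2 t2
  apply mul_left_cancel₀ (neg_ne_zero.2 h4)
  rw [h3, t15]
  field_simp
  ring

/-- By `sum_legendreTerm_div`, 2 H_n is minus the sum of L_n(k)/k, so only C(2k,k)²/16^k - L_n(k)
matters; its p² coefficient is the sum just evaluated. -/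
theorem red_sum_choose_sq_div {n : ℕ} (hn : p = 2 * n + 1) (hp5 : 5 < p) {β : ZMod p}
    (hβ : Red p (bernoulli (p - 3)) β) :
    Red p ((∑ k ∈ Icc 1 n, ((2 * k).choose k : ℚ) ^ 2 / ((k : ℚ) * 16 ^ k) + 2 * harm 1 n) /
      (p : ℚ) ^ 2) (-(7 / 2) * β) := by
  have hp := natCast_prime_ne_zero (p := p)
  have e : 2 * harm 1 n = -∑ k ∈ Icc 1 n, legendreTerm n k / k := by
    rw [sum_legendreTerm_div]; ring
  rw [← sum_chooseSqZ_mul_oddHarmZ hn hp5 hβ, e, ← sub_eq_add_neg, ← sum_sub_distrib, sum_div]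
  refine Red.sum fun k hk => ?_
  rw [mem_Icc] at hk
  have hk0 : (k : ℚ) ≠ 0 := by exact_mod_cast (by lia : k ≠ 0)
  refine (((red_choose_sq hp5 k).div (Red.natCast k) (natCast_zmod_ne_zero hk.1 (by lia))).mul
    (red_prod_one_sub_sq hn hk.2).neg).of_eq ?_ (by rw [neg_neg])
  rw [legendreTerm_half hn]
  field_simp
  ring

theorem theorem1p1 (p : ℕ) (hp : p.Prime) (hp5 : 5 < p) :
    RatModEq p 1
      (∑ k ∈ Finset.Icc 1 ((p - 1) / 2),
        (-1 : ℚ) ^ k / ((k : ℚ) ^ 3 * ((2 * k).choose k : ℚ)))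
      (-2 * bernoulli (p - 3)) ∧
    RatModEq p 2
      (∑ k ∈ Finset.Icc 1 ((p - 1) / 2),
        (-1 : ℚ) ^ k / (k : ℚ) ^ 2 * ((2 * k).choose k : ℚ))
      (56 / 15 * (p : ℚ) * bernoulli (p - 3)) ∧
    RatModEq p 3
      (∑ k ∈ Finset.Icc 1 ((p - 1) / 2),
        ((2 * k).choose k : ℚ) ^ 2 / ((k : ℚ) * 16 ^ k))
      (-2 * harmonic ((p - 1) / 2) - 7 / 2 * (p : ℚ) ^ 2 * bernoulli (p - 3)) ∧
    RatModEq p 1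
      (-(4 / (p : ℚ) ^ 2) * ∑ k ∈ Finset.Icc ((p + 1) / 2) (p - 1),
        ((2 * k).choose k : ℚ) ^ 2 / ((k : ℚ) * 16 ^ k))
      (∑ k ∈ Finset.Icc 1 ((p - 1) / 2),
        (16 : ℚ) ^ k / ((k : ℚ) ^ 3 * ((2 * k).choose k : ℚ) ^ 2)) ∧
    RatModEq p 1
      (∑ k ∈ Finset.Icc 1 ((p - 1) / 2),
        (16 : ℚ) ^ k / ((k : ℚ) ^ 3 * ((2 * k).choose k : ℚ) ^ 2))
      (-14 * bernoulli (p - 3)) := by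
  have : Fact p.Prime := ⟨hp⟩
  obtain ⟨n, hn⟩ : ∃ n, p = 2 * n + 1 := hp.odd_of_ne_two (by lia)
  obtain ⟨β, hβ⟩ := exists_red_bernoulli (p := p) (r := p - 3) (by lia)
  obtain ⟨t2, t3, t5⟩ := zmod_two_three_five_ne_zero hp5
  have t15 : (15 : ZMod p) ≠ 0 := by
    rw [show (15 : ZMod p) = 3 * 5 by norm_num]; exact mul_ne_zero t3 t5
  have hA := red_aperySum hn
  rw [aperySumZ_half hn hp5 hβ] at hA
  have hC := red_sum_one_div_choose_sq hn hp5
  rw [sum_one_div_chooseSqZ hn hp5 hβ] at hC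
  have hU := red_sum_choose_sq_upper hn hp5
  rw [sum_one_div_chooseSqZ hn hp5 hβ] at hU
  have ratModEq_one : ∀ {x y : ℚ} {a : ZMod p}, Red p x a → Red p y a → RatModEq p 1 x y :=
    fun {x y a} hx hy => by
      simpa using Red.ratModEq_succ (n := 0) (x := x) (by simpa using hx) hy
  rw [show (p - 1) / 2 = n by lia, show (p + 1) / 2 = n + 1 by lia]
  refine ⟨ratModEq_one hA ((Red.ofNat 2).neg.mul hβ), ?_, ?_, ratModEq_one hU hC,
    ratModEq_one hC ((Red.ofNat 14).neg.mul hβ)⟩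
  · obtain ⟨z, hz, h⟩ := Red.ratModEq_succ (n := 1)
      ((red_dualAperySum_half_div hn hp5 hβ).of_eq (by rw [pow_one]) rfl)
      (((Red.ofNat 56).div (Red.ofNat 15) t15).mul hβ)
    refine ⟨z, hz, ?_⟩
    rw [← dualAperySum]
    linear_combination h
  · obtain ⟨z, hz, h⟩ := Red.ratModEq_succ (n := 2) (red_sum_choose_sq_div hn hp5 hβ)
      ((((Red.ofNat 7).div (Red.ofNat 2) t2).neg).mul hβ)
    refine ⟨z, hz, ?_⟩
    have e : harmonic n = harm 1 n := by
      rw [harmonic_eq_sum_Icc, harm]; simp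
    rw [e]
    linear_combination h
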